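/- Consider a single-cell downlink in which a base station with $M$ antennas and transmit power $P>0$ per resource block serves $K=TK_B$ single-antenna users, $K_B\ge1$ users in each of the $T\ge 1$ resource blocks of a round-robin scheduling period. The channel vectors $\mathbf g_1,\dots,\mathbf g_K$ are independent with law $\mathcal{CN}(\mathbf 0,\beta \mathbf I_M)$, $\beta>0$, and the noise variance is $\sigma_n^2>0$. The first $K_M$ users ($K_M\le K_B$, $K_M<K$) underreport: the base station believes in the matrix $\mathbf F$ with rows $\mathbf f_k=\sqrt\delta\,\mathbf g_k$ for $k\le K_M$ and $\mathbf f_k=\mathbf g_k$ for $k>K_M$, where $0<\delta<1$. In each block it uses zero-forcing with respect to the reported channels and max-min power control (equal perceived SNRs, total power $P$); rates are $\log_2(1+\mathrm{SINR})$ with the SINR really received. With channel-magnitude grouping the users are ordered by decreasing reported magnitude $\|\mathbf f_k\|^2$ and served in this order in groups of $K_B$; with random grouping the order is uniformly random and independent of the channels. Let $R^{a}$ be the ergodic rate per user, averaged over the period, when all users report accurately, and $R^{m}$ the ergodic rate per honest user when $K_M$ users underreport; the rate loss is $(R^{a}-R^{m})/R^{a}$, written $\theta^{CM}$ for channel-magnitude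 grouping and $\theta^{rand}$ for random grouping. Let $\theta^{ex}(K_M|K_B)$ be the rate loss, defined in the same way, when only $K_B$ users exist and all are served in one block, and put $$\theta(K_M|K_B)=1-\frac{\log_2\Bigl(1+\frac{P\beta}{\sigma_n^2}\frac{M-K_B}{K_B-K_M+K_M/\delta}\Bigr)}{\log_2\Bigl(1+\frac{P\beta}{\sigma_n^2}\frac{M-K_B}{K_B}\Bigr)},\qquad \theta^{CM}_{upper}=\frac{K_B-K_M}{K-K_M}\,\theta(K_M|K_B).$$ Let further $$\Theta^{CM}=-\frac{K_M(T-1)}{T(K-K_M)}+\frac{R_T^{a}}{T R^{r}}-\frac{(K_B-K_M)R_T^{m}}{(K-K_M)R^{r}},$$ where $R^{r}=\log_2\bigl(1+\frac{P\beta}{\sigma_n^2}\frac{M-K_B}{K_B}\bigr)$, $R_T^{a}$ and $R_T^{m}$ are $\log_2\bigl(1+\frac{P}{\sigma_n^2}\frac{M-K_B}{(M-1)A}\bigr)$ with $A=A_T^a=\sum_{k=1}^{K_B}\int_0^\infty \frac{f_{(k)}(x)}{x}dx$ and $A=A_T^m=\frac{K_M}{\delta\beta(M-1)}+\sum_{k=1}^{K_B-K_M}\int_0^\infty\frac{\bar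 f_{(k)}(x)}{x}dx$ respectively, and $f_{(k)}$, $\bar f_{(k)}$ are the densities of the $k$-th smallest value in a sample of size $K$, respectively $K-K_M$, from the gamma distribution with shape $M$ and scale $\beta$. Then, all other parameters being fixed as $M\to\infty$: 1. $\theta^{CM}_{upper}$ is an asymptotic upper bound of the rate loss per honest user: for every $\varepsilon>0$, $\theta^{CM}\le\theta^{CM}_{upper}+\varepsilon/\log_2M$ for all large $M$. More precisely, $\theta^{CM}-\Theta^{CM}=o(1/\log M)$, and $\Theta^{CM}\le\theta^{CM}_{upper}$ for every $M>K_B$. 2. If $K_M<K_B$, then $\theta^{ex}(K_M|K_B)-\theta(K_M|K_B)=o(1/\log M)$, so $\theta(K_M|K_B)$ is the asymptotic single-block rate loss. 3. If $K_M=K_B$, then $\theta^{CM}_{upper}=0$. 4. If $K_M=1$, the bound is the rate loss under random grouping: $\theta^{rand}=\frac{K_B-1}{K-1}\,\theta^{ex}(1|K_B)$ for every $M\ge K_B$, and $\theta^{rand}-\theta^{CM}_{upper}=o(1/\log M)$. -/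

import Mathlib

open Filter Topology MeasureTheory ProbabilityTheory
open scoped Matrix

noncomputable section

namespace MisreportRR

/-! ### The channel -/

/-- The circularly symmetric complex Gaussian law `CN(0, v)`: independent real and imaginary parts,
each centred with variance `v / 2`. -/
def complexGaussian (v : ℝ) : Measure ℂ :=
  ((gaussianReal 0 (v / 2).toNNReal).prod (gaussianReal 0 (v / 2).toNNReal)).map
    (fun z : ℝ × ℝ => (⟨z.1, z.2⟩ : ℂ))

/-- The law of the channel matrix of `K` homogeneous users and `M` antennas: row `k` is the channel
of user `k`, and all entries are i.i.d. `CN(0, β)` (Rayleigh fading). -/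
def channelLaw (β : ℝ) (K M : ℕ) : Measure (Fin K → Fin M → ℂ) :=
  Measure.pi fun _ => Measure.pi fun _ => complexGaussian β

/-! ### Misreporting -/

/-- The first `KM` users scale their reported channel magnitude by `δ`; all others are honest. -/
def reportScale (δ : ℝ) (KM : ℕ) {K : ℕ} (k : Fin K) : ℝ :=
  if k.val < KM then δ else 1

/-- The reported channel matrix `F = Δ^{1/2} G`. -/
def reported (δ : ℝ) (KM : ℕ) {K M : ℕ} (G : Fin K → Fin M → ℂ) : Fin K → Fin M → ℂ :=
  fun k j => (Real.sqrt (reportScale δ KM k) : ℂ) * G k j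

/-- The channel magnitude (squared Euclidean norm) of each user for a channel matrix. -/
def channelMagnitude {K M : ℕ} (G : Fin K → Fin M → ℂ) (k : Fin K) : ℝ :=
  ∑ j, ‖G k j‖ ^ 2

/-! ### Transmission in one resource block: zero forcing with max-min power control -/

/-- The zero-forcing matrix `W = Fᴴ (F Fᴴ)⁻¹`. -/
def zfMatrix {n M : ℕ} (F : Matrix (Fin n) (Fin M) ℂ) : Matrix (Fin M) (Fin n) ℂ :=
  Fᴴ * (F * Fᴴ)⁻¹

/-- `d_k = 1 / ‖w_k‖`, where `w_k` is the `k`-th column of `W`; `d_k ^ 2` is the effective channel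
gain of user `k`. -/
def effGain {n M : ℕ} (F : Matrix (Fin n) (Fin M) ℂ) (k : Fin n) : ℝ :=
  1 / Real.sqrt (∑ j, ‖zfMatrix F j k‖ ^ 2)

/-- The max-min power allocation: the powers `P_k` with `∑ k, P_k = P` for which all the SNRs
`P_k * d_k ^ 2 / σ²` perceived by the base station coincide. -/
def maxMinPower (P : ℝ) {n M : ℕ} (F : Matrix (Fin n) (Fin M) ℂ) (k : Fin n) : ℝ :=
  P * (1 / effGain F k ^ 2) / ∑ j, 1 / effGain F j ^ 2

/-- The matrix `W D P^{1/2}` that maps the data vector to the transmitted vector, computed by the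
base station from the channel matrix `F` that it believes in. -/
def precoder (P : ℝ) {n M : ℕ} (F : Matrix (Fin n) (Fin M) ℂ) : Matrix (Fin M) (Fin n) ℂ :=
  zfMatrix F * Matrix.diagonal fun k => ((effGain F k * Real.sqrt (maxMinPower P F k) : ℝ) : ℂ)

/-- The signal-to-interference-plus-noise ratio really received by user `k` of the block, when `G`
is the true channel matrix of the block, `F` the reported one, `P` the transmit power and `N₀` the
noise variance. -/
def sinr (P N₀ : ℝ) {n M : ℕ} (G F : Matrix (Fin n) (Fin M) ℂ) (k : Fin n) : ℝ :=
  ‖(G * precoder P F) k k‖ ^ 2 /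
    (N₀ + ∑ j ∈ Finset.univ.erase k, ‖(G * precoder P F) k j‖ ^ 2)

/-- The rate of user `k` of the block, in bits per channel use. -/
def rate (P N₀ : ℝ) {n M : ℕ} (G F : Matrix (Fin n) (Fin M) ℂ) (k : Fin n) : ℝ :=
  Real.logb 2 (1 + sinr P N₀ G F k)

/-! ### All users served in one resource block -/

/-- The ergodic rate per honest user when `n` users, the first `KM` of which misreport with ratio
`δ`, are all served in one resource block. With `KM = 0` this is the accurate-reporting rate. -/
def singleBlockRate (P β N₀ δ : ℝ) (n KM M : ℕ) : ℝ :=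
  ∫ G : Fin n → Fin M → ℂ,
    (∑ k : Fin n, if k.val < KM then 0 else
      rate P N₀ (Matrix.of G) (Matrix.of (reported δ KM G)) k) / ((n : ℝ) - KM)
    ∂(channelLaw β n M)

/-- The single-block rate loss `θ(KM | n) = (R^a - R^m) / R^a` with `M` antennas. -/
def singleBlockLoss (P β N₀ δ : ℝ) (n KM M : ℕ) : ℝ :=
  (singleBlockRate P β N₀ δ n 0 M - singleBlockRate P β N₀ δ n KM M) /
    singleBlockRate P β N₀ δ n 0 M

/-- The large-`M` expression of the single-block rate loss `θ(KM | n)`. -/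
def asympSingleBlockLoss (P β N₀ δ : ℝ) (n KM M : ℕ) : ℝ :=
  1 - Real.logb 2 (1 + P * β / N₀ * (((M : ℝ) - n) / ((n : ℝ) - KM + KM / δ))) /
      Real.logb 2 (1 + P * β / N₀ * (((M : ℝ) - n) / n))

/-! ### Round-robin scheduling of `K = T * KB` users in `T` blocks of `KB` users -/

/-- The users of block `t`, when the users are put in the order `π` and then cut into
consecutive groups of size `KB`. -/
def group {T KB : ℕ} (π : Equiv.Perm (Fin (T * KB))) (t : Fin T) (i : Fin KB) : Fin (T * KB) :=
  π (finProdFinEquiv (t, i))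

/-- The average rate of the honest users over one scheduling period, for the channel realization
`G` and the user order `π`. -/
def periodRate (P N₀ δ : ℝ) {T KB M : ℕ} (KM : ℕ) (π : Equiv.Perm (Fin (T * KB)))
    (G : Fin (T * KB) → Fin M → ℂ) : ℝ :=
  (∑ t : Fin T, ∑ i : Fin KB, if (group π t i).val < KM then 0 else
    rate P N₀ ((Matrix.of G).submatrix (group π t) id)
      ((Matrix.of (reported δ KM G)).submatrix (group π t) id) i) /
    (((T * KB : ℕ) : ℝ) - KM)

/-- The order of the users by decreasing channel magnitude: cutting it into consecutive groups of
`KB` users is repeatedly selecting the `KB` users with the largest magnitudes. -/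
def magnitudeOrder {K M : ℕ} (F : Fin K → Fin M → ℂ) : Equiv.Perm (Fin K) :=
  Tuple.sort fun k => -channelMagnitude F k

/-- The ergodic rate per honest user with grouping by reported channel magnitude. -/
def rateCM (P β N₀ δ : ℝ) (T KB KM M : ℕ) : ℝ :=
  ∫ G : Fin (T * KB) → Fin M → ℂ, periodRate P N₀ δ KM (magnitudeOrder (reported δ KM G)) G
    ∂(channelLaw β (T * KB) M)

/-- The ergodic rate per honest user with uniformly random grouping, independent of the channels. -/
def rateRand (P β N₀ δ : ℝ) (T KB KM M : ℕ) : ℝ :=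
  (∑ π : Equiv.Perm (Fin (T * KB)),
    ∫ G : Fin (T * KB) → Fin M → ℂ, periodRate P N₀ δ KM π G ∂(channelLaw β (T * KB) M)) /
    Fintype.card (Equiv.Perm (Fin (T * KB)))

/-- The rate loss per honest user under channel-magnitude grouping, with `M` antennas. -/
def lossCM (P β N₀ δ : ℝ) (T KB KM M : ℕ) : ℝ :=
  (rateCM P β N₀ δ T KB 0 M - rateCM P β N₀ δ T KB KM M) / rateCM P β N₀ δ T KB 0 M

/-- The rate loss per honest user under random grouping, with `M` antennas. -/
def lossRand (P β N₀ δ : ℝ) (T KB KM M : ℕ) : ℝ :=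
  (rateRand P β N₀ δ T KB 0 M - rateRand P β N₀ δ T KB KM M) / rateRand P β N₀ δ T KB 0 M

/-! ### Large-`M` expression of the rate loss under channel-magnitude grouping -/

/-- The law of the `(k+1)`-th smallest value in a sample of size `N` from `μ`. -/
def orderStatLaw (μ : Measure ℝ) (N : ℕ) (k : Fin N) : Measure ℝ :=
  (Measure.pi fun _ : Fin N => μ).map fun x => x (Tuple.sort x k)

/-- `∑_{k = 1}^{n} ∫ f_(k)(x) / x dx`, where `f_(k)` is the density of the `k`-th smallest value in
a sample of size `N` from the gamma distribution with shape `M` and scale `β` (rate `1 / β`). -/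
def invOrderStatSum (β : ℝ) (M N n : ℕ) : ℝ :=
  ∑ k ∈ Finset.univ.filter (fun k : Fin N => k.val < n),
    ∫ x, 1 / x ∂(orderStatLaw (gammaMeasure (M : ℝ) (1 / β)) N k)

/-- `A_T^a` -/
def coeffAccurate (β : ℝ) (T KB M : ℕ) : ℝ :=
  invOrderStatSum β M (T * KB) KB

/-- `A_T^m` -/
def coeffMisreport (β δ : ℝ) (T KB KM M : ℕ) : ℝ :=
  KM / (δ * β * ((M : ℝ) - 1)) + invOrderStatSum β M (T * KB - KM) (KB - KM)

/-- The large-`M` expression of the rate under random grouping and accurate reporting. -/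
def asympRateRand (P β N₀ : ℝ) (KB M : ℕ) : ℝ :=
  Real.logb 2 (1 + P * β / N₀ * (((M : ℝ) - KB) / KB))

/-- The large-`M` expression of the rate in the last block, in terms of `A_T^a` or `A_T^m`. -/
def asympRateLast (P N₀ A : ℝ) (KB M : ℕ) : ℝ :=
  Real.logb 2 (1 + P / N₀ * (((M : ℝ) - KB) / (((M : ℝ) - 1) * A)))

/-- The large-`M` expression of the rate loss under channel-magnitude grouping. -/
def asympLossCM (P β N₀ δ : ℝ) (T KB KM M : ℕ) : ℝ :=
  -(KM * ((T : ℝ) - 1) / (T * (T * KB - KM)))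
    + asympRateLast P N₀ (coeffAccurate β T KB M) KB M / (T * asympRateRand P β N₀ KB M)
    - ((KB : ℝ) - KM) * asympRateLast P N₀ (coeffMisreport β δ T KB KM M) KB M /
        ((T * KB - KM) * asympRateRand P β N₀ KB M)

/-! ### The upper bound -/

/-- `((KB - KM) / (K - KM)) * θ(KM | KB)`, with `K = T * KB` and `θ` the large-`M` expression of
the single-block rate loss. -/
def upperLossCM (P β N₀ δ : ℝ) (T KB KM M : ℕ) : ℝ :=
  ((KB : ℝ) - KM) / (T * KB - KM) * asympSingleBlockLoss P β N₀ δ KB KM M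

end MisreportRR

end

/-!
Zero forcing diagonalizes the channel even when the reported magnitudes are wrong, so that an honest
user of a block receives the rate `log₂ (1 + P / (N₀ ∑ j, qⱼ / sⱼ))`, where `sⱼ` is the report scale
of user `j` and `qⱼ`, the squared norm of its zero-forcing vector, is the `j`-th diagonal entry of
`(G Gᴴ)⁻¹` (`rate_eq_blockRate`, `zfCost_eq`). Linearly dependent channels need no separate
treatment: both sides are then `0`.

The entries of `G Gᴴ / (M β)` deviate from those of the identity by a mean square of order `1 / M`
(`integral_gramDev_le`). When the deviation is small, the rate is close to
`log₂ (1 + P β M / (N₀ ∑ j, 1 / sⱼ))`, by continuity of the matrix inverse; otherwise it is at most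
the rate of beamforming to one user alone. Together this bounds the error by an arbitrarily small
constant plus `O(log M)` times the deviation (`exists_abs_blockRate_sub_le`), whose mean tends to
`0`. No distribution of an inverse Wishart matrix is needed. The same deviation controls the order
by reported magnitude: when it is small, the misreporting users come last, all in the last block
(`magnitudeOrder_reported_val_lt_iff`). Hence every ergodic rate, exact or large-antenna, equals
`log₂ M` plus a constant plus `o(1)`, and every loss times `log₂ M` converges. All the `o(1 / log M)`
claims say that two of these limits agree. For the large-antenna expression this uses that all order
statistics of a gamma sample concentrate at the mean (`tendsto_mul_invOrderStatSum`).

The bound on the large-antenna expression for each `M > KB` has two ingredients. The sum of the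
inverses of the `n` smallest values of a sample is at least the sum over any other choice of `n`
values (`add_invOrderStatSum_le`), and `x ↦ log (1 + c / x)` is convex (`logb_one_add_div_sub_le`).

Under random grouping with one misreporting user, only the block of that user is affected, and its
expected rate is the single-block one, since the rows of the channel matrix are exchangeable and the
block rate does not depend on the order of the users (`integral_periodRate_one`).
-/

noncomputable section

namespace MisreportRR

/-! ### Moments of the channel -/

instance isProbabilityMeasure_complexGaussian (v : ℝ) :
    IsProbabilityMeasure (complexGaussian v) :=
  Measure.isProbabilityMeasure_map (Measurable.aemeasurable (by
    exact Complex.measurableEquivRealProd.symm.measurable))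

instance isProbabilityMeasure_channelLaw (β : ℝ) (K M : ℕ) :
    IsProbabilityMeasure (channelLaw β K M) := by
  unfold channelLaw; infer_instance

lemma integral_complexGaussian {E : Type*} [NormedAddCommGroup E] [NormedSpace ℝ E] (v : ℝ)
    (f : ℂ → E) :
    ∫ z, f z ∂(complexGaussian v) =
      ∫ x : ℝ × ℝ, f ⟨x.1, x.2⟩
        ∂((gaussianReal 0 (v / 2).toNNReal).prod (gaussianReal 0 (v / 2).toNNReal)) :=
  integral_map_equiv Complex.measurableEquivRealProd.symm f

lemma integrable_complexGaussian {E : Type*} [NormedAddCommGroup E] (v : ℝ) (f : ℂ → E) :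
    Integrable f (complexGaussian v) ↔ Integrable (fun x : ℝ × ℝ => f ⟨x.1, x.2⟩)
        ((gaussianReal 0 (v / 2).toNNReal).prod (gaussianReal 0 (v / 2).toNNReal)) :=
  integrable_map_equiv Complex.measurableEquivRealProd.symm f

lemma integrable_pow_gaussianReal (v : NNReal) (n : ℕ) :
    Integrable (fun x : ℝ => x ^ n) (gaussianReal 0 v) := by
  have h := (memLp_id_gaussianReal (μ := 0) (v := v) n).integrable_norm_pow'
  simpa [← abs_pow] using (integrable_norm_iff (by fun_prop)).1 (by simpa using h)

lemma integral_sq_gaussianReal (v : NNReal) :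
    ∫ x : ℝ, x ^ 2 ∂(gaussianReal 0 v) = v := by
  have h := variance_fun_id_gaussianReal (μ := 0) (v := v)
  rw [variance_of_integral_eq_zero (by fun_prop) (by simp)] at h
  exact h

lemma integrable_norm_pow_four_complexGaussian (v : ℝ) :
    Integrable (fun z : ℂ => ‖z‖ ^ 4) (complexGaussian v) := by
  rw [integrable_complexGaussian]
  have e : (fun x : ℝ × ℝ => ‖(⟨x.1, x.2⟩ : ℂ)‖ ^ 4) =
      fun x => x.1 ^ 4 + 2 * (x.1 ^ 2 * x.2 ^ 2) + x.2 ^ 4 := by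
    funext x
    have : ‖(⟨x.1, x.2⟩ : ℂ)‖ ^ 2 = x.1 ^ 2 + x.2 ^ 2 := by
      rw [Complex.sq_norm, Complex.normSq_mk]; ring
    calc _ = (‖(⟨x.1, x.2⟩ : ℂ)‖ ^ 2) ^ 2 := by ring
      _ = _ := by rw [this]; ring
  rw [e]
  have h4 := integrable_pow_gaussianReal (v / 2).toNNReal 4
  have h2 := integrable_pow_gaussianReal (v / 2).toNNReal 2
  exact ((h4.comp_fst _).add ((h2.mul_prod h2).const_mul 2)).add (h4.comp_snd _)

lemma integrable_id_complexGaussian (v : ℝ) :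
    Integrable (fun z : ℂ => z) (complexGaussian v) := by
  refine ((integrable_norm_pow_four_complexGaussian v).add (integrable_const 1)).mono'
    (by fun_prop) (ae_of_all _ fun z => ?_)
  simp only [Pi.add_apply]
  nlinarith [sq_nonneg (‖z‖ ^ 2 - 1 / 2), sq_nonneg (‖z‖ - 1 / 2)]

lemma integral_id_complexGaussian (v : ℝ) : ∫ z, z ∂(complexGaussian v) = 0 := by
  have hi := integrable_id_complexGaussian v
  have hre := integral_re hi
  have him := integral_im hi
  apply Complex.ext
  · refine Eq.trans (Eq.trans hre.symm ?_) Complex.zero_re.symm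
    rw [integral_complexGaussian]
    simpa using integral_fun_fst (μ := gaussianReal 0 (v / 2).toNNReal)
      (ν := gaussianReal 0 (v / 2).toNNReal) (fun x : ℝ => x)
  · refine Eq.trans (Eq.trans him.symm ?_) Complex.zero_im.symm
    rw [integral_complexGaussian]
    simpa using integral_fun_snd (μ := gaussianReal 0 (v / 2).toNNReal)
      (ν := gaussianReal 0 (v / 2).toNNReal) (fun x : ℝ => x)

lemma integral_norm_sq_complexGaussian {v : ℝ} (hv : 0 ≤ v) :
    ∫ z, ‖z‖ ^ 2 ∂(complexGaussian v) = v := by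
  have h2 := integrable_pow_gaussianReal (v / 2).toNNReal 2
  rw [integral_complexGaussian]
  have e : (fun x : ℝ × ℝ => ‖(⟨x.1, x.2⟩ : ℂ)‖ ^ 2) = fun x => x.1 ^ 2 + x.2 ^ 2 := by
    funext x
    rw [Complex.sq_norm, Complex.normSq_mk]; ring
  rw [e, integral_add (h2.comp_fst _) (h2.comp_snd _),
    integral_fun_fst (fun x : ℝ => x ^ 2), integral_fun_snd (fun x : ℝ => x ^ 2),
    integral_sq_gaussianReal]
  simp [Real.coe_toNNReal _ (by positivity : 0 ≤ v / 2)]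

lemma iIndepFun_entries (β : ℝ) (K M : ℕ) :
    iIndepFun (fun (p : Fin K × Fin M) (G : Fin K → Fin M → ℂ) => G p.1 p.2)
      (channelLaw β K M) := by
  have h := iIndepFun_uncurry_infinitePi' (ι := Fin K) (κ := Fin M)
    (fun _ _ => complexGaussian β) (X := fun _ _ z => z) (by fun_prop)
  simp only [Measure.infinitePi_eq_pi] at h
  exact h

lemma measurePreserving_entry (β : ℝ) {K M : ℕ} (k : Fin K) (m : Fin M) :
    MeasurePreserving (fun G : Fin K → Fin M → ℂ => G k m) (channelLaw β K M)
      (complexGaussian β) :=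
  (measurePreserving_eval (fun _ : Fin M => complexGaussian β) m).comp
    (measurePreserving_eval (fun _ : Fin K => Measure.pi fun _ : Fin M => complexGaussian β) k)

/-- The coordinates of an i.i.d. family picked by an injection are again i.i.d. -/
lemma measurePreserving_pi_comp {α : Type*} [MeasurableSpace α] (μ : Measure α)
    [IsProbabilityMeasure μ] {n K : ℕ} {ι : Fin n → Fin K} (hι : Function.Injective ι) :
    MeasurePreserving (fun (x : Fin K → α) (i : Fin n) => x (ι i))
      (Measure.pi fun _ => μ) (Measure.pi fun _ => μ) := by
  refine ⟨by fun_prop, ?_⟩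
  have h : iIndepFun (fun (k : Fin K) (x : Fin K → α) => x k) (Measure.pi fun _ => μ) :=
    iIndepFun_pi (X := fun _ x => x) (fun _ => aemeasurable_id)
  have h' := h.precomp hι
  rw [iIndepFun_iff_map_fun_eq_pi_map (fun i => (measurable_pi_apply (ι i)).aemeasurable)] at h'
  refine h'.trans ?_
  congr 1
  funext i
  exact (measurePreserving_eval (fun _ : Fin K => μ) (ι i)).map_eq

/-- The rows of the channel matrix picked by an injection again form a channel matrix. -/
lemma measurePreserving_rows (β : ℝ) {n K M : ℕ} {ι : Fin n → Fin K}
    (hι : Function.Injective ι) :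
    MeasurePreserving (fun (G : Fin K → Fin M → ℂ) (i : Fin n) => G (ι i))
      (channelLaw β K M) (channelLaw β n M) :=
  measurePreserving_pi_comp (Measure.pi fun _ : Fin M => complexGaussian β) hι

/-- The Gram matrix `G Gᴴ`, entrywise. -/
def gram {K M : ℕ} (G : Fin K → Fin M → ℂ) (i j : Fin K) : ℂ :=
  ∑ m, G i m * (starRingEnd ℂ) (G j m)

/-- The squared Frobenius distance of the normalized Gram matrix `G Gᴴ / (M β)` from the identity.
It measures how far the channels are from being orthogonal and of equal magnitude. -/
def gramDev (β : ℝ) {K M : ℕ} (G : Fin K → Fin M → ℂ) : ℝ :=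
  ∑ i, ∑ j, ‖gram G i j / ((M : ℂ) * β) - if i = j then 1 else 0‖ ^ 2

@[fun_prop]
lemma measurable_gram {K M : ℕ} (i j : Fin K) :
    Measurable (fun G : Fin K → Fin M → ℂ => gram G i j) := by
  unfold gram; fun_prop

lemma integral_entry_mul {β : ℝ} (hβ : 0 ≤ β) {K M : ℕ} (i j : Fin K) (m : Fin M) :
    ∫ G, G i m * (starRingEnd ℂ) (G j m) ∂(channelLaw β K M) = if i = j then (β : ℂ) else 0 := by
  by_cases hij : i = j
  · subst hij
    have e : ∀ z : ℂ, z * (starRingEnd ℂ) z = ((‖z‖ ^ 2 : ℝ) : ℂ) := fun z => by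
      rw [Complex.mul_conj, Complex.sq_norm]
    rw [if_pos rfl]
    simp_rw [e]
    rw [integral_complex_ofReal]
    congr 1
    have h := (measurePreserving_entry β i m (K := K) (M := M))
    refine Eq.trans ?_ (integral_norm_sq_complexGaussian hβ)
    rw [← h.map_eq, integral_map h.measurable.aemeasurable (by fun_prop)]
  · rw [if_neg hij]
    have hind : IndepFun (fun G : Fin K → Fin M → ℂ => G i m) (fun G => G j m)
        (channelLaw β K M) :=
      (iIndepFun_entries β K M).indepFun (i := (i, m)) (j := (j, m)) (by simp [hij])
    have hc : Measurable (starRingEnd ℂ) := Complex.continuous_conj.measurable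
    have hind' := hind.comp measurable_id hc
    have := hind'.integral_fun_mul_eq_mul_integral
      (by fun_prop : Measurable fun G : Fin K → Fin M → ℂ => G i m).aestronglyMeasurable
      (hc.comp (by fun_prop : Measurable fun G : Fin K → Fin M → ℂ => G j m)).aestronglyMeasurable
    refine this.trans ?_
    have h := (measurePreserving_entry β i m (K := K) (M := M))
    have h0 : ∫ G, G i m ∂(channelLaw β K M) = 0 := by
      rw [← integral_id_complexGaussian β, ← h.map_eq,
        integral_map h.measurable.aemeasurable (by fun_prop)]
    simp [h0]

/-- The second moment of a centred entrywise summand of the Gram matrix is bounded by a constant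
that does not depend on the number of antennas. -/
lemma memLp_entry_mul {β : ℝ} {K M : ℕ} (i j : Fin K) (m : Fin M) (c : ℂ)
    {φ : ℂ →L[ℝ] ℝ} (hφ : ∀ z, |φ z| ≤ ‖z‖) :
    MemLp (fun G : Fin K → Fin M → ℂ => φ (G i m * (starRingEnd ℂ) (G j m) - c)) 2
        (channelLaw β K M) ∧
      ∫ G, (φ (G i m * (starRingEnd ℂ) (G j m) - c)) ^ 2 ∂(channelLaw β K M) ≤
        2 * ∫ z, ‖z‖ ^ 4 ∂(complexGaussian β) + 2 * ‖c‖ ^ 2 := by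
  have hint : ∀ i, Integrable (fun G : Fin K → Fin M → ℂ => ‖G i m‖ ^ 4) (channelLaw β K M) :=
    fun i => (measurePreserving_entry β i m).integrable_comp_of_integrable
      (integrable_norm_pow_four_complexGaussian β)
  have hval : ∀ i, ∫ G : Fin K → Fin M → ℂ, ‖G i m‖ ^ 4 ∂(channelLaw β K M) =
      ∫ z, ‖z‖ ^ 4 ∂(complexGaussian β) := fun i => by
    have h := (measurePreserving_entry β i m (K := K) (M := M))
    rw [← h.map_eq, integral_map h.measurable.aemeasurable (by fun_prop)]
  have hmeas : Measurable
      (fun G : Fin K → Fin M → ℂ => φ (G i m * (starRingEnd ℂ) (G j m) - c)) := by fun_prop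
  have hb : ∀ G : Fin K → Fin M → ℂ, (φ (G i m * (starRingEnd ℂ) (G j m) - c)) ^ 2 ≤
      ‖G i m‖ ^ 4 + ‖G j m‖ ^ 4 + 2 * ‖c‖ ^ 2 := fun G => by
    have h1 := hφ (G i m * (starRingEnd ℂ) (G j m) - c)
    have h2 := norm_sub_le (G i m * (starRingEnd ℂ) (G j m)) c
    rw [norm_mul, RCLike.norm_conj] at h2
    have h3 := pow_le_pow_left₀ (abs_nonneg _) (h1.trans h2) 2
    rw [sq_abs] at h3
    nlinarith [sq_nonneg (‖G i m‖ ^ 2 - ‖G j m‖ ^ 2), sq_nonneg (‖G i m‖ * ‖G j m‖ - ‖c‖)]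
  have hdom := ((hint i).add (hint j)).add (integrable_const (2 * ‖c‖ ^ 2))
  have hsq : Integrable (fun G : Fin K → Fin M → ℂ =>
      (φ (G i m * (starRingEnd ℂ) (G j m) - c)) ^ 2) (channelLaw β K M) :=
    hdom.mono' (hmeas.pow_const 2).aestronglyMeasurable
      (ae_of_all _ fun G => by rw [Real.norm_eq_abs, abs_of_nonneg (sq_nonneg _)]; exact hb G)
  refine ⟨(memLp_two_iff_integrable_sq hmeas.aestronglyMeasurable).2 hsq, ?_⟩
  refine (integral_mono hsq hdom hb).trans (le_of_eq ?_)
  rw [integral_add' ((hint i).add (hint j)) (integrable_const _), integral_add' (hint i) (hint j),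
    hval, hval]
  simp
  ring

/-- The summands of an entry of the Gram matrix over the antennas are independent, so its variance
grows only linearly with the number of antennas. -/
lemma integral_gram_sub_sq_le {β : ℝ} (hβ : 0 ≤ β) {K M : ℕ} (i j : Fin K)
    {φ : ℂ →L[ℝ] ℝ} (hφ : ∀ z, |φ z| ≤ ‖z‖) :
    Integrable (fun G : Fin K → Fin M → ℂ =>
        (φ (gram G i j - M * if i = j then (β : ℂ) else 0)) ^ 2) (channelLaw β K M) ∧
      ∫ G : Fin K → Fin M → ℂ, (φ (gram G i j - M * if i = j then (β : ℂ) else 0)) ^ 2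
          ∂(channelLaw β K M) ≤
        M * (2 * ∫ z, ‖z‖ ^ 4 ∂(complexGaussian β) + 2 * β ^ 2) := by
  set c : ℂ := if i = j then (β : ℂ) else 0 with hcdef
  have hcn : ‖c‖ ^ 2 ≤ β ^ 2 := by
    rw [hcdef]; split_ifs
    · simp
    · simpa using sq_nonneg β
  set X : Fin M → (Fin K → Fin M → ℂ) → ℝ :=
    fun m G => φ (G i m * (starRingEnd ℂ) (G j m) - c) with hX
  have hL : ∀ m, MemLp (X m) 2 (channelLaw β K M) := fun m => (memLp_entry_mul i j m c hφ).1
  have hmean : ∀ m, ∫ G, X m G ∂(channelLaw β K M) = 0 := fun m => by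
    have hm : MemLp (fun G : Fin K → Fin M → ℂ => G i m * (starRingEnd ℂ) (G j m) - c) 2
        (channelLaw β K M) := by
      have h1 := (memLp_entry_mul (β := β) i j m c (φ := Complex.reCLM) Complex.abs_re_le_norm).1
      have h2 := (memLp_entry_mul (β := β) i j m c (φ := Complex.imCLM) Complex.abs_im_le_norm).1
      exact memLp_re_im_iff.1 ⟨h1, h2⟩
    have hi := hm.integrable (by norm_num)
    have h0 := φ.integral_comp_comm hi
    refine h0.trans ?_
    have hi' : Integrable (fun G : Fin K → Fin M → ℂ => G i m * (starRingEnd ℂ) (G j m))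
        (channelLaw β K M) := by
      exact (hi.add (integrable_const c)).congr (ae_of_all _ fun G => by simp)
    rw [integral_sub hi' (integrable_const c), integral_entry_mul hβ]
    simp [hcdef]
  have hind : Set.Pairwise (↑(Finset.univ : Finset (Fin M)))
      fun m m' => IndepFun (X m) (X m') (channelLaw β K M) := by
    intro m _ m' _ hne
    have h := (iIndepFun_entries β K M).indepFun_prodMk_prodMk (fun p => by fun_prop)
      (i, m) (j, m) (i, m') (j, m') (by simp [hne]) (by simp [hne]) (by simp [hne])
      (by simp [hne])
    have hψ : Measurable fun p : ℂ × ℂ => φ (p.1 * (starRingEnd ℂ) p.2 - c) := by fun_prop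
    exact h.comp hψ hψ
  have hsum : (fun G : Fin K → Fin M → ℂ => φ (gram G i j - M * c)) = ∑ m, X m := by
    funext G
    have hMc : φ (M * c) = M * φ c := by
      rw [← nsmul_eq_mul, map_nsmul, nsmul_eq_mul]
    simp [hX, gram, Finset.sum_apply, ← map_sum, Finset.sum_sub_distrib, hMc]
  have hLs : MemLp (∑ m, X m) 2 (channelLaw β K M) := memLp_finsetSum' _ fun m _ => hL m
  have hmean' : ∫ G, (∑ m, X m) G ∂(channelLaw β K M) = 0 := by
    simp only [Finset.sum_apply]
    rw [integral_finsetSum _ fun m _ => (hL m).integrable (by norm_num)]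
    simp [hmean]
  have hvar := IndepFun.variance_sum (fun m _ => hL m) hind
  rw [variance_of_integral_eq_zero hLs.aestronglyMeasurable.aemeasurable hmean'] at hvar
  have e : (fun G : Fin K → Fin M → ℂ => (φ (gram G i j - M * c)) ^ 2) =
      fun G => ((∑ m, X m) G) ^ 2 := by
    rw [← hsum]
  rw [e]
  refine ⟨hLs.integrable_sq, ?_⟩
  have hvar' : ∫ G, ((∑ m, X m) G) ^ 2 ∂(channelLaw β K M) =
      ∑ m, variance (X m) (channelLaw β K M) := by
    simpa using hvar
  rw [hvar']
  refine (Finset.sum_le_sum fun m _ => show _ ≤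
    (2 * ∫ z, ‖z‖ ^ 4 ∂(complexGaussian β) + 2 * β ^ 2) from ?_).trans (by simp [mul_add])
  rw [variance_of_integral_eq_zero (hL m).aestronglyMeasurable.aemeasurable (hmean m)]
  have := (memLp_entry_mul (β := β) i j m c hφ).2
  simp only [hX]
  linarith

@[fun_prop]
lemma measurable_gramDev {β : ℝ} {K M : ℕ} :
    Measurable (fun G : Fin K → Fin M → ℂ => gramDev β G) := by
  unfold gramDev; fun_prop

lemma gramDev_nonneg {β : ℝ} {K M : ℕ} (G : Fin K → Fin M → ℂ) : 0 ≤ gramDev β G := by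
  unfold gramDev; positivity

lemma integral_gramDev_le {β : ℝ} (hβ : 0 < β) (K : ℕ) :
    ∃ C, 0 ≤ C ∧ ∀ M : ℕ, 0 < M →
      Integrable (fun G : Fin K → Fin M → ℂ => gramDev β G) (channelLaw β K M) ∧
      ∫ G : Fin K → Fin M → ℂ, gramDev β G ∂(channelLaw β K M) ≤ C / M := by
  set V := 2 * ∫ z, ‖z‖ ^ 4 ∂(complexGaussian β) + 2 * β ^ 2 with hV
  have hV0 : 0 ≤ V := by
    have : 0 ≤ ∫ z, ‖z‖ ^ 4 ∂(complexGaussian β) := integral_nonneg fun z => by positivity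
    positivity
  refine ⟨K * (K * (2 * V / β ^ 2)), by positivity, fun M hM => ?_⟩
  have hterm : ∀ i j : Fin K, (fun G : Fin K → Fin M → ℂ =>
      ‖gram G i j / ((M : ℂ) * β) - if i = j then 1 else 0‖ ^ 2) = fun G =>
      (1 / (M * β) ^ 2) * ((Complex.reCLM (gram G i j - M * if i = j then (β : ℂ) else 0)) ^ 2 +
      (Complex.imCLM (gram G i j - M * if i = j then (β : ℂ) else 0)) ^ 2) := by
    intro i j
    funext G
    have h1 : gram G i j / ((M : ℂ) * β) - (if i = j then 1 else 0) =
        (gram G i j - M * if i = j then (β : ℂ) else 0) / ((M : ℂ) * β) := by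
      have : (M : ℂ) ≠ 0 := by exact_mod_cast hM.ne'
      have : (β : ℂ) ≠ 0 := by exact_mod_cast hβ.ne'
      split_ifs
      · field_simp
      · simp
    rw [h1, norm_div, div_pow, Complex.sq_norm, Complex.normSq_apply]
    simp only [Complex.reCLM_apply, Complex.imCLM_apply, norm_mul, Complex.norm_natCast,
      Complex.norm_real, Real.norm_eq_abs, abs_of_pos hβ]
    ring
  have hI : ∀ i j : Fin K, Integrable (fun G : Fin K → Fin M → ℂ =>
      ‖gram G i j / ((M : ℂ) * β) - if i = j then 1 else 0‖ ^ 2) (channelLaw β K M) ∧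
      ∫ G : Fin K → Fin M → ℂ, ‖gram G i j / ((M : ℂ) * β) - if i = j then 1 else 0‖ ^ 2
        ∂(channelLaw β K M) ≤ 2 * V / β ^ 2 / M := by
    intro i j
    rw [hterm]
    obtain ⟨h1, h1'⟩ := integral_gram_sub_sq_le hβ.le (M := M) i j (φ := Complex.reCLM)
      Complex.abs_re_le_norm
    obtain ⟨h2, h2'⟩ := integral_gram_sub_sq_le hβ.le (M := M) i j (φ := Complex.imCLM)
      Complex.abs_im_le_norm
    refine ⟨(h1.add h2).const_mul _, ?_⟩
    rw [integral_const_mul, integral_add h1 h2]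
    refine (mul_le_mul_of_nonneg_left (add_le_add h1' h2') (by positivity)).trans (le_of_eq ?_)
    rw [← hV]
    field_simp
    ring
  refine ⟨integrable_finsetSum _ fun i _ => integrable_finsetSum _ fun j _ => (hI i j).1, ?_⟩
  simp only [gramDev]
  rw [integral_finsetSum _ fun i _ => integrable_finsetSum _ fun j _ => (hI i j).1]
  simp_rw [integral_finsetSum _ fun j _ => (hI _ j).1]
  refine (Finset.sum_le_sum fun i _ => Finset.sum_le_sum fun j _ => (hI i j).2).trans
    (le_of_eq ?_)
  simp
  ring

/-! ### The rate in one resource block -/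

/-- The squared norm of the zero-forcing vector of user `j`, the inverse of its effective gain. -/
def zfCost {n M : ℕ} (G : Fin n → Fin M → ℂ) (j : Fin n) : ℝ :=
  ∑ m, ‖zfMatrix (Matrix.of G) m j‖ ^ 2

/-- The total power cost per unit SNR of a block with true channels `G` and report scales `s`. -/
def blockCost {n M : ℕ} (s : Fin n → ℝ) (G : Fin n → Fin M → ℂ) : ℝ :=
  ∑ j, 1 / s j * zfCost G j

/-- The common rate of the honest users in a block with true channels `G` and report scales `s`.
For linearly dependent channels the cost is the junk value `0` and the rate is `0`. -/
def blockRate (P N₀ : ℝ) {n M : ℕ} (s : Fin n → ℝ) (G : Fin n → Fin M → ℂ) : ℝ :=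
  Real.logb 2 (1 + P / (N₀ * blockCost s G))

lemma zfCost_nonneg {n M : ℕ} (G : Fin n → Fin M → ℂ) (j : Fin n) : 0 ≤ zfCost G j := by
  unfold zfCost; positivity

lemma blockCost_nonneg {n M : ℕ} {s : Fin n → ℝ} (hs : ∀ j, 0 < s j) (G : Fin n → Fin M → ℂ) :
    0 ≤ blockCost s G :=
  Finset.sum_nonneg fun j _ => mul_nonneg (one_div_nonneg.2 (hs j).le) (zfCost_nonneg G j)

lemma mul_conjTranspose_eq_gram {n M : ℕ} (G : Fin n → Fin M → ℂ) :
    Matrix.of G * (Matrix.of G)ᴴ = Matrix.of (gram G) := by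
  ext i j
  simp [Matrix.mul_apply, gram]

lemma zfMatrix_eq_zero {n M : ℕ} {F : Matrix (Fin n) (Fin M) ℂ} (h : ¬ IsUnit (F * Fᴴ).det) :
    zfMatrix F = 0 := by
  rw [zfMatrix, Matrix.nonsing_inv_apply_not_isUnit _ h, Matrix.mul_zero]

lemma mul_zfMatrix {n M : ℕ} {F : Matrix (Fin n) (Fin M) ℂ} (h : IsUnit (F * Fᴴ).det) :
    F * zfMatrix F = 1 := by
  rw [zfMatrix, ← Matrix.mul_assoc, Matrix.mul_nonsing_inv _ h]

lemma zfCost_eq {n M : ℕ} (G : Fin n → Fin M → ℂ) (j : Fin n) :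
    zfCost G j = ((Matrix.of (gram G))⁻¹ j j).re := by
  have h : (zfMatrix (Matrix.of G))ᴴ * zfMatrix (Matrix.of G) = (Matrix.of (gram G))⁻¹ := by
    rw [← mul_conjTranspose_eq_gram]
    by_cases hu : IsUnit (Matrix.of G * (Matrix.of G)ᴴ).det
    · rw [zfMatrix, Matrix.conjTranspose_mul, Matrix.conjTranspose_conjTranspose,
        Matrix.conjTranspose_nonsing_inv, Matrix.conjTranspose_mul,
        Matrix.conjTranspose_conjTranspose, Matrix.mul_assoc, ← Matrix.mul_assoc (Matrix.of G),
        Matrix.mul_nonsing_inv _ hu, Matrix.mul_one]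
    · rw [zfMatrix_eq_zero hu, Matrix.mul_zero, Matrix.nonsing_inv_apply_not_isUnit _ hu]
  rw [← h, Matrix.mul_apply, zfCost, Complex.re_sum]
  refine Finset.sum_congr rfl fun m _ => ?_
  rw [Matrix.conjTranspose_apply, Complex.sq_norm, Complex.normSq_apply]
  simp

lemma one_le_mul_zfCost {n M : ℕ} {G : Fin n → Fin M → ℂ}
    (h : IsUnit (Matrix.of G * (Matrix.of G)ᴴ).det) (k : Fin n) :
    1 ≤ (∑ m, ‖G k m‖ ^ 2) * zfCost G k := by
  have h1 : ∑ m, G k m * zfMatrix (Matrix.of G) m k = 1 := by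
    have := congrFun (congrFun (mul_zfMatrix h) k) k
    simpa [Matrix.mul_apply] using this
  have h2 : 1 ≤ ∑ m, ‖G k m‖ * ‖zfMatrix (Matrix.of G) m k‖ := by
    calc (1 : ℝ) = ‖∑ m, G k m * zfMatrix (Matrix.of G) m k‖ := by rw [h1]; simp
      _ ≤ _ := (norm_sum_le _ _).trans (le_of_eq (by simp))
  calc (1 : ℝ) ≤ (∑ m, ‖G k m‖ * ‖zfMatrix (Matrix.of G) m k‖) ^ 2 := one_le_pow₀ h2
    _ ≤ _ := Finset.sum_mul_sq_le_sq_mul_sq _ _ _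

/-- Scaling the reported channels scales the zero-forcing vectors inversely. -/
lemma zfMatrix_scaled {n M : ℕ} {s : Fin n → ℝ} (hs : ∀ j, 0 < s j) (G : Fin n → Fin M → ℂ)
    (m : Fin M) (j : Fin n) :
    zfMatrix (Matrix.of fun k i => (Real.sqrt (s k) : ℂ) * G k i) m j =
      zfMatrix (Matrix.of G) m j * ((Real.sqrt (s j))⁻¹ : ℝ) := by
  set S : Matrix (Fin n) (Fin n) ℂ := Matrix.diagonal fun k => (Real.sqrt (s k) : ℂ) with hS
  set S' : Matrix (Fin n) (Fin n) ℂ :=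
    Matrix.diagonal fun k => (((Real.sqrt (s k))⁻¹ : ℝ) : ℂ) with hS'
  have hne : ∀ k, (Real.sqrt (s k) : ℂ) ≠ 0 := fun k => by
    exact_mod_cast (Real.sqrt_pos.2 (hs k)).ne'
  have hSS : S * S' = 1 := by
    rw [hS, hS', Matrix.diagonal_mul_diagonal, ← Matrix.diagonal_one]
    congr 1
    funext k
    push_cast
    exact mul_inv_cancel₀ (hne k)
  have hSi : S⁻¹ = S' := Matrix.inv_eq_right_inv hSS
  have hF : (Matrix.of fun k i => (Real.sqrt (s k) : ℂ) * G k i) = S * Matrix.of G := by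
    ext k i
    simp [hS, Matrix.diagonal_mul]
  have hSh : Sᴴ = S := by
    rw [hS, Matrix.diagonal_conjTranspose]
    congr 1
    funext k
    simp
  have : zfMatrix (S * Matrix.of G) = zfMatrix (Matrix.of G) * S' := by
    rw [zfMatrix, zfMatrix, Matrix.conjTranspose_mul, hSh,
      show S * Matrix.of G * ((Matrix.of G)ᴴ * S) = S * ((Matrix.of G * (Matrix.of G)ᴴ) * S) by
        simp only [Matrix.mul_assoc],
      Matrix.mul_inv_rev, Matrix.mul_inv_rev, hSi]
    calc _ = (Matrix.of G)ᴴ * ((S * S') * (Matrix.of G * (Matrix.of G)ᴴ)⁻¹ * S') := by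
          simp only [Matrix.mul_assoc]
      _ = _ := by rw [hSS, Matrix.one_mul, Matrix.mul_assoc]
  rw [hF, this, hS', Matrix.mul_diagonal]

/-- With zero forcing, misreporting a magnitude causes no interference: an honest user only sees the
power lost to the misreporting users. -/
lemma rate_eq_blockRate {P : ℝ} (hP : 0 ≤ P) (N₀ : ℝ) {n M : ℕ} {s : Fin n → ℝ}
    (hs : ∀ j, 0 < s j) (G : Fin n → Fin M → ℂ) {k : Fin n} (hk : s k = 1) :
    rate P N₀ (Matrix.of G) (Matrix.of fun k i => (Real.sqrt (s k) : ℂ) * G k i) k =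
      blockRate P N₀ s G := by
  set F : Matrix (Fin n) (Fin M) ℂ := Matrix.of fun k i => (Real.sqrt (s k) : ℂ) * G k i with hF
  set c : Fin n → ℝ := fun j => ∑ m, ‖zfMatrix F m j‖ ^ 2 with hc
  have hcq : ∀ j, c j = 1 / s j * zfCost G j := fun j => by
    simp only [hc, zfCost, hF, Finset.mul_sum, zfMatrix_scaled hs]
    refine Finset.sum_congr rfl fun m _ => ?_
    rw [norm_mul, mul_pow, Complex.norm_real, Real.norm_eq_abs, sq_abs, inv_pow,
      Real.sq_sqrt (hs j).le]
    ring
  have hcost : ∑ j, c j = blockCost s G := Finset.sum_congr rfl fun j _ => hcq j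
  have hgain : ∀ j, effGain F j ^ 2 = 1 / c j := fun j => by
    rw [effGain, div_pow, Real.sq_sqrt (by positivity)]
    simp [hc]
  have hc0 : ∀ j, 0 ≤ c j := fun j => by simp only [hc]; positivity
  have hzF : ∀ m j, zfMatrix F m j = zfMatrix (Matrix.of G) m j * ((Real.sqrt (s j))⁻¹ : ℝ) :=
    zfMatrix_scaled hs G
  clear_value c F
  unfold rate blockRate
  congr 2
  by_cases hu : IsUnit (Matrix.of G * (Matrix.of G)ᴴ).det
  · have hGF : Matrix.of G * zfMatrix F =
        Matrix.diagonal fun k => (((Real.sqrt (s k))⁻¹ : ℝ) : ℂ) := by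
      have : zfMatrix F = zfMatrix (Matrix.of G) *
          Matrix.diagonal fun k => (((Real.sqrt (s k))⁻¹ : ℝ) : ℂ) := by
        ext m j
        rw [hzF, Matrix.mul_diagonal]
      rw [this, ← Matrix.mul_assoc, mul_zfMatrix hu, Matrix.one_mul]
    have hGp : Matrix.of G * precoder P F = Matrix.diagonal fun k =>
        (((Real.sqrt (s k))⁻¹ : ℝ) : ℂ) *
          ((effGain F k * Real.sqrt (maxMinPower P F k) : ℝ) : ℂ) := by
      rw [precoder, ← Matrix.mul_assoc, hGF, Matrix.diagonal_mul_diagonal]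
    have hcpos : 0 < c k := by
      rw [hcq, hk]
      have := one_le_mul_zfCost hu k
      rcases (zfCost_nonneg G k).lt_or_eq with h | h
      · simpa using h
      · rw [← h] at this; norm_num at this
    have hmm : maxMinPower P F k = P * c k / ∑ j, c j := by
      simp only [maxMinPower, hgain, one_div_one_div]
    have hcs : 0 < ∑ j, c j :=
      Finset.sum_pos' (fun j _ => hc0 j) ⟨k, Finset.mem_univ k, hcpos⟩
    have hmm0 : 0 ≤ maxMinPower P F k := by
      rw [hmm]; exact div_nonneg (mul_nonneg hP hcpos.le) hcs.le
    have hoff : ∑ j ∈ Finset.univ.erase k, ‖(Matrix.of G * precoder P F) k j‖ ^ 2 = 0 := by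
      refine Finset.sum_eq_zero fun j hj => ?_
      rw [hGp, Matrix.diagonal_apply_ne _ (Finset.ne_of_mem_erase hj).symm, norm_zero]
      norm_num
    have hon : ‖(Matrix.of G * precoder P F) k k‖ ^ 2 = P / ∑ j, c j := by
      rw [hGp, Matrix.diagonal_apply_eq, hk, Real.sqrt_one, inv_one, Complex.ofReal_one, one_mul,
        Complex.norm_real, Real.norm_eq_abs, sq_abs, mul_pow, hgain, Real.sq_sqrt hmm0, hmm]
      have := hcpos.ne'
      field_simp
    rw [sinr, hoff, hon, ← hcost, add_zero, div_div, mul_comm N₀]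
  · have hz : ∀ j, zfCost G j = 0 := fun j => by
      simp [zfCost, zfMatrix_eq_zero hu]
    have hz0 : zfMatrix F = 0 := by
      ext m j
      rw [hzF, zfMatrix_eq_zero hu]
      simp
    simp [sinr, precoder, hz0, blockCost, hz]

lemma zfMatrix_rows_perm {n M : ℕ} (e : Equiv.Perm (Fin n)) (G : Fin n → Fin M → ℂ) (m : Fin M)
    (j : Fin n) :
    zfMatrix (Matrix.of fun i => G (e i)) m j = zfMatrix (Matrix.of G) m (e j) := by
  have h : (Matrix.of fun i => G (e i)) = (Matrix.of G).submatrix e id := rfl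
  have h2 : (Matrix.of G).submatrix e id * ((Matrix.of G).submatrix e id)ᴴ =
      (Matrix.of G * (Matrix.of G)ᴴ).submatrix e e := by
    ext i j
    simp [Matrix.mul_apply]
  rw [h, zfMatrix, h2, Matrix.inv_submatrix_equiv, zfMatrix, Matrix.mul_apply, Matrix.mul_apply]
  exact Equiv.sum_comp e fun i => (Matrix.of G)ᴴ m i * (Matrix.of G * (Matrix.of G)ᴴ)⁻¹ i (e j)

lemma blockRate_rows_perm (P N₀ : ℝ) {n M : ℕ} (e : Equiv.Perm (Fin n)) (s : Fin n → ℝ)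
    (G : Fin n → Fin M → ℂ) :
    blockRate P N₀ (fun i => s (e i)) (fun i => G (e i)) = blockRate P N₀ s G := by
  unfold blockRate blockCost zfCost
  simp only [zfMatrix_rows_perm]
  rw [Equiv.sum_comp e fun j => 1 / s j * ∑ m, ‖zfMatrix (Matrix.of G) m j‖ ^ 2]

lemma blockRate_nonneg {P N₀ : ℝ} (hP : 0 ≤ P) (hN₀ : 0 ≤ N₀) {n M : ℕ} {s : Fin n → ℝ}
    (hs : ∀ j, 0 < s j) (G : Fin n → Fin M → ℂ) : 0 ≤ blockRate P N₀ s G := by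
  refine Real.logb_nonneg one_lt_two ?_
  have := div_nonneg hP (mul_nonneg hN₀ (blockCost_nonneg hs G))
  linarith

/-- Beamforming to user `k` alone is no worse than zero forcing. -/
lemma blockRate_le {P N₀ : ℝ} (hP : 0 ≤ P) (hN₀ : 0 < N₀) {n M : ℕ} {s : Fin n → ℝ}
    (hs : ∀ j, 0 < s j) (hs1 : ∀ j, s j ≤ 1) (G : Fin n → Fin M → ℂ) (k : Fin n) :
    blockRate P N₀ s G ≤ Real.logb 2 (1 + P / N₀ * ∑ m, ‖G k m‖ ^ 2) := by
  have hsum : 0 ≤ ∑ m, ‖G k m‖ ^ 2 := by positivity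
  have key : P / (N₀ * blockCost s G) ≤ P / N₀ * ∑ m, ‖G k m‖ ^ 2 := by
    by_cases hu : IsUnit (Matrix.of G * (Matrix.of G)ᴴ).det
    · have h1 := one_le_mul_zfCost hu k
      have h2 : zfCost G k ≤ blockCost s G := by
        have h3 : zfCost G k ≤ 1 / s k * zfCost G k :=
          le_mul_of_one_le_left (zfCost_nonneg G k) ((one_le_div (hs k)).2 (hs1 k))
        exact h3.trans (Finset.single_le_sum (f := fun j => 1 / s j * zfCost G j) (fun j _ =>
          mul_nonneg (one_div_nonneg.2 (hs j).le) (zfCost_nonneg G j)) (Finset.mem_univ k))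
      have h4 : 1 ≤ (∑ m, ‖G k m‖ ^ 2) * blockCost s G :=
        h1.trans (mul_le_mul_of_nonneg_left h2 hsum)
      have h5 : 0 < blockCost s G := by
        rcases (blockCost_nonneg hs G).lt_or_eq with h | h
        · exact h
        · rw [← h] at h4; norm_num at h4
      rw [div_le_iff₀ (by positivity)]
      calc P = P * 1 := (mul_one P).symm
        _ ≤ P * ((∑ m, ‖G k m‖ ^ 2) * blockCost s G) := mul_le_mul_of_nonneg_left h4 hP
        _ = _ := by field_simp
    · have : blockCost s G = 0 := by simp [blockCost, zfCost, zfMatrix_eq_zero hu]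
      rw [this]
      simp only [mul_zero, div_zero]
      positivity
  have := div_nonneg hP (mul_nonneg hN₀.le (blockCost_nonneg hs G))
  exact Real.logb_le_logb_of_le one_lt_two (by linarith) (by linarith)

lemma measurable_blockRate (P N₀ : ℝ) {n M : ℕ} (s : Fin n → ℝ) :
    Measurable (fun G : Fin n → Fin M → ℂ => blockRate P N₀ s G) := by
  have hgram : Continuous (fun G : Fin n → Fin M → ℂ => Matrix.of (gram G)) := by
    refine continuous_matrix fun i j => ?_
    have hc := Complex.continuous_conj
    simp only [gram, Matrix.of_apply]
    fun_prop
  have hq : ∀ j, Measurable (fun G : Fin n → Fin M → ℂ => zfCost G j) := fun j => by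
    simp only [zfCost_eq, Matrix.inv_def, Ring.inverse_eq_inv', Matrix.smul_apply, smul_eq_mul]
    have h1 : Measurable (fun G : Fin n → Fin M → ℂ => (Matrix.of (gram G)).det) :=
      hgram.matrix_det.measurable
    have h2 : Measurable (fun G : Fin n → Fin M → ℂ => (Matrix.of (gram G)).adjugate j j) :=
      (hgram.matrix_adjugate.matrix_elem j j).measurable
    exact Complex.measurable_re.comp (h1.inv.mul h2)
  unfold blockRate blockCost Real.logb
  fun_prop

/-! ### Concentration of the block rate -/

lemma exists_forall_abs_inv_apply_sub_one_le (n : ℕ) {η : ℝ} (hη : 0 < η) :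
    ∃ ε > 0, ∀ A : Matrix (Fin n) (Fin n) ℂ,
      (∀ i j, ‖A i j - if i = j then 1 else 0‖ < ε) → ∀ j, |(A⁻¹ j j).re - 1| ≤ η := by
  have hcont : ∀ j, ContinuousAt (fun A : Matrix (Fin n) (Fin n) ℂ => (A⁻¹ j j).re) 1 := fun j => by
    simp only [Matrix.inv_def, Ring.inverse_eq_inv', Matrix.smul_apply, smul_eq_mul]
    have h1 : ContinuousAt (fun A : Matrix (Fin n) (Fin n) ℂ => A.det⁻¹) 1 :=
      (continuous_id.matrix_det.continuousAt).inv₀ (by simp)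
    have h2 : ContinuousAt (fun A : Matrix (Fin n) (Fin n) ℂ => A.adjugate j j) 1 :=
      (continuous_id.matrix_adjugate.matrix_elem j j).continuousAt
    exact Complex.continuous_re.continuousAt.comp (h1.mul h2)
  have hev : ∀ᶠ A : Fin n → Fin n → ℂ in 𝓝 (1 : Matrix (Fin n) (Fin n) ℂ),
      ∀ j, |((Matrix.of A)⁻¹ j j).re - 1| ≤ η := by
    refine eventually_all.2 fun j => ?_
    have h := (hcont j).tendsto
    simp only [inv_one, Matrix.one_apply_eq, Complex.one_re] at h
    filter_upwards [h (Metric.closedBall_mem_nhds _ hη)] with A hA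
    exact hA
  obtain ⟨ε, hε, hball⟩ := Metric.eventually_nhds_iff.1 hev
  refine ⟨ε, hε, fun A hA => hball ?_⟩
  refine (dist_pi_lt_iff hε).2 fun i => (dist_pi_lt_iff hε).2 fun j => ?_
  rw [dist_eq_norm]
  exact hA i j

lemma abs_logb_one_add_sub_le {x y r : ℝ} (hx : 0 ≤ x) (hy : 0 ≤ y) (hr : 1 ≤ r)
    (hxy : x ≤ r * y) (hyx : y ≤ r * x) :
    |Real.logb 2 (1 + x) - Real.logb 2 (1 + y)| ≤ Real.logb 2 r := by
  have hle : ∀ {a b : ℝ}, 0 ≤ a → 0 ≤ b → a ≤ r * b →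
      Real.logb 2 (1 + a) ≤ Real.logb 2 r + Real.logb 2 (1 + b) := fun ha hb hab => by
    rw [← Real.logb_mul (by positivity) (by positivity)]
    exact Real.logb_le_logb_of_le one_lt_two (by linarith) (by linarith)
  rw [abs_sub_le_iff]
  constructor <;> linarith [hle hx hy hxy, hle hy hx hyx]

lemma norm_gram_sub_le {β : ℝ} {K M : ℕ} (G : Fin K → Fin M → ℂ) (i j : Fin K) :
    ‖gram G i j / ((M : ℂ) * β) - if i = j then 1 else 0‖ ^ 2 ≤ gramDev β G := by
  unfold gramDev
  refine le_trans ?_ (Finset.single_le_sum (f := fun i => ∑ j,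
    ‖gram G i j / ((M : ℂ) * β) - if i = j then 1 else 0‖ ^ 2)
    (fun i _ => by positivity) (Finset.mem_univ i))
  exact Finset.single_le_sum (f := fun j =>
    ‖gram G i j / ((M : ℂ) * β) - if i = j then 1 else 0‖ ^ 2)
    (fun j _ => by positivity) (Finset.mem_univ j)

lemma gram_self {K M : ℕ} (G : Fin K → Fin M → ℂ) (k : Fin K) :
    gram G k k = ((∑ m, ‖G k m‖ ^ 2 : ℝ) : ℂ) := by
  simp only [gram, Complex.ofReal_sum]
  exact Finset.sum_congr rfl fun m _ => by rw [Complex.mul_conj, Complex.sq_norm]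

lemma abs_magnitude_sub_one_sq_le {β : ℝ} {K M : ℕ} (G : Fin K → Fin M → ℂ) (k : Fin K) :
    ((∑ m, ‖G k m‖ ^ 2) / (M * β) - 1) ^ 2 ≤ gramDev β G := by
  have h := norm_gram_sub_le (β := β) G k k
  rw [gram_self, if_pos rfl] at h
  have e : (((∑ m, ‖G k m‖ ^ 2 : ℝ) : ℂ) / ((M : ℂ) * β) - 1) =
      (((∑ m, ‖G k m‖ ^ 2) / (M * β) - 1 : ℝ) : ℂ) := by push_cast; rfl
  rw [e, Complex.norm_real, Real.norm_eq_abs, sq_abs] at h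
  exact h

/-- The rate of a block, up to an arbitrarily small error and a multiple of the deviation of the
Gram matrix, depends only on the report scales. -/
lemma exists_abs_blockRate_sub_le {P β N₀ : ℝ} (hP : 0 < P) (hβ : 0 < β) (hN₀ : 0 < N₀)
    {n : ℕ} (hn : 0 < n) {κ : ℝ} (hκ : 0 < κ) :
    ∃ C, 0 ≤ C ∧ ∀ (K M : ℕ), 0 < M → ∀ ι : Fin n → Fin K, Function.Injective ι →
      ∀ s : Fin n → ℝ, (∀ j, 0 < s j) → (∀ j, s j ≤ 1) → ∀ G : Fin K → Fin M → ℂ,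
      |blockRate P N₀ s (fun i => G (ι i)) -
          Real.logb 2 (1 + P * β / N₀ * (M / ∑ j, 1 / s j))| ≤
        κ + C * (1 + Real.logb 2 (1 + P * β / N₀ * M)) * gramDev β G := by
  set r : ℝ := 2 ^ κ with hr
  have hr1 : 1 < r := Real.one_lt_rpow one_lt_two hκ
  have hrκ : Real.logb 2 r = κ := Real.logb_rpow (by norm_num) (by norm_num)
  have hr0 : 0 < r := by linarith
  obtain ⟨ε, hε, hinv⟩ := exists_forall_abs_inv_apply_sub_one_le n (η := 1 - 1 / r)
    (by rw [sub_pos, div_lt_one hr0]; exact hr1)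
  refine ⟨4 / ε ^ 2 + 2, by positivity, fun K M hM ι hι s hs hs1 G => ?_⟩
  have hM' : (0 : ℝ) < M := by exact_mod_cast hM
  have hD := gramDev_nonneg (β := β) G
  set k : Fin n := ⟨0, hn⟩
  have hS1 : 1 ≤ ∑ j, 1 / s j := by
    have h1 : 1 ≤ 1 / s k := (one_le_div (hs k)).2 (hs1 k)
    exact h1.trans (Finset.single_le_sum (f := fun j => 1 / s j)
      (fun j _ => one_div_nonneg.2 (hs j).le) (Finset.mem_univ k))
  set S := ∑ j, 1 / s j with hS
  have hS0 : 0 < S := by linarith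
  set Lg := Real.logb 2 (1 + P * β / N₀ * M)
  have hLg0 : 0 ≤ Lg := Real.logb_nonneg one_lt_two (by
    have : 0 ≤ P * β / N₀ * M := by positivity
    linarith)
  by_cases hcase : gramDev β G < ε ^ 2
  · set A : Matrix (Fin n) (Fin n) ℂ :=
      Matrix.of fun i j => gram G (ι i) (ι j) / ((M : ℂ) * β) with hA
    have hAe : ∀ i j, ‖A i j - if i = j then 1 else 0‖ < ε := fun i j => by
      have h := (norm_gram_sub_le (β := β) G (ι i) (ι j)).trans_lt hcase
      have h' := lt_of_pow_lt_pow_left₀ 2 hε.le h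
      simpa [hA, hι.eq_iff] using h'
    have hAi := hinv A hAe
    have hB : Matrix.of (gram fun i => G (ι i)) = Matrix.diagonal (fun _ => (M : ℂ) * β) * A := by
      ext i j
      have : (M : ℂ) ≠ 0 := by exact_mod_cast hM.ne'
      have : (β : ℂ) ≠ 0 := by exact_mod_cast hβ.ne'
      simp only [hA, Matrix.of_apply, Matrix.diagonal_mul]
      have h3 : gram (fun i => G (ι i)) i j = gram G (ι i) (ι j) := rfl
      rw [h3]; field_simp
    have hdi : (Matrix.diagonal (fun _ : Fin n => (M : ℂ) * β))⁻¹ =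
        Matrix.diagonal (fun _ => ((1 / (M * β) : ℝ) : ℂ)) := by
      refine Matrix.inv_eq_right_inv ?_
      rw [Matrix.diagonal_mul_diagonal, ← Matrix.diagonal_one]
      congr 1
      funext _
      have : (M : ℂ) ≠ 0 := by exact_mod_cast hM.ne'
      have : (β : ℂ) ≠ 0 := by exact_mod_cast hβ.ne'
      push_cast; field_simp
    have hq : ∀ j, zfCost (fun i => G (ι i)) j = (A⁻¹ j j).re / (M * β) := fun j => by
      rw [zfCost_eq, hB, Matrix.mul_inv_rev, hdi, Matrix.mul_diagonal, Complex.re_mul_ofReal]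
      ring
    have hlo : 1 / r * S / (M * β) ≤ blockCost s (fun i => G (ι i)) := by
      rw [blockCost, hS, Finset.mul_sum, Finset.sum_div]
      refine Finset.sum_le_sum fun j _ => ?_
      rw [hq]
      have h1 := (abs_le.1 (hAi j)).1
      have h2 : 1 / r ≤ (A⁻¹ j j).re := by linarith
      rw [mul_comm (1 / r), mul_div_assoc]
      have := hs j
      gcongr
    have hhi : blockCost s (fun i => G (ι i)) ≤ r * S / (M * β) := by
      rw [blockCost, hS, Finset.mul_sum, Finset.sum_div]
      refine Finset.sum_le_sum fun j _ => ?_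
      rw [hq]
      have h1 := (abs_le.1 (hAi j)).2
      have h3 : 2 - 1 / r ≤ r := by
        have : r + 1 / r - 2 = (r - 1) ^ 2 / r := by field_simp; ring
        have : 0 ≤ (r - 1) ^ 2 / r := by positivity
        linarith
      have h2 : (A⁻¹ j j).re ≤ r := by linarith
      rw [mul_comm r, mul_div_assoc]
      have := hs j
      gcongr
    have hc0 : 0 < blockCost s (fun i => G (ι i)) := lt_of_lt_of_le (by positivity) hlo
    have hmain := abs_logb_one_add_sub_le (x := P / (N₀ * blockCost s (fun i => G (ι i))))
      (y := P * β / N₀ * (M / S)) (r := r) (by positivity) (by positivity) hr1.le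
      (by
        rw [div_le_iff₀ (by positivity)]
        calc P = r * (P * β / N₀ * (M / S)) * (N₀ * (1 / r * S / (M * β))) := by field_simp
          _ ≤ _ := by gcongr)
      (by
        rw [show r * (P / (N₀ * blockCost s fun i => G (ι i))) =
          (r * P) / (N₀ * blockCost s fun i => G (ι i)) by ring, le_div_iff₀ (by positivity)]
        calc _ ≤ P * β / N₀ * (M / S) * (N₀ * (r * S / (M * β))) := by gcongr
          _ = r * P := by field_simp)
    rw [hrκ] at hmain
    refine hmain.trans (le_add_of_nonneg_right ?_)
    positivity
  · have hDε : 1 ≤ gramDev β G / ε ^ 2 := (one_le_div (by positivity)).2 (not_lt.1 hcase)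
    have hb0 := blockRate_nonneg hP.le hN₀.le hs (fun i => G (ι i))
    have hb1 := blockRate_le hP.le hN₀ hs hs1 (fun i => G (ι i)) k
    set u := (∑ m, ‖G (ι k) m‖ ^ 2) / (M * β) with hu
    have hu0 : 0 ≤ u := by positivity
    have hu1 : u ≤ 2 + gramDev β G := by
      have := abs_magnitude_sub_one_sq_le (β := β) G (ι k)
      rw [← hu] at this
      nlinarith [sq_nonneg (u - 2)]
    have hb2 : Real.logb 2 (1 + P / N₀ * ∑ m, ‖G (ι k) m‖ ^ 2) ≤ Lg + 2 * u := by
      have e : P / N₀ * ∑ m, ‖G (ι k) m‖ ^ 2 = P * β / N₀ * M * u := by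
        rw [hu]; field_simp
      have h1 : Real.logb 2 (1 + P * β / N₀ * M * u) ≤
          Real.logb 2 ((1 + P * β / N₀ * M) * (1 + u)) := by
        have : 0 ≤ P * β / N₀ * M := by positivity
        exact Real.logb_le_logb_of_le one_lt_two (by positivity) (by nlinarith)
      rw [Real.logb_mul (by positivity) (by positivity)] at h1
      have h2 : Real.logb 2 (1 + u) ≤ 2 * u := by
        rw [Real.logb, div_le_iff₀ (Real.log_pos one_lt_two)]
        have := Real.log_le_sub_one_of_pos (show 0 < 1 + u by linarith)
        have := Real.log_two_gt_d9
        nlinarith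
      rw [e]; linarith
    have ht0 : 0 ≤ Real.logb 2 (1 + P * β / N₀ * (M / S)) := Real.logb_nonneg one_lt_two (by
      have : 0 ≤ P * β / N₀ * (M / S) := by positivity
      linarith)
    have ht1 : Real.logb 2 (1 + P * β / N₀ * (M / S)) ≤ Lg := by
      refine Real.logb_le_logb_of_le one_lt_two (by positivity) ?_
      gcongr
      exact div_le_self hM'.le hS1
    have hfin : Lg + 4 + 2 * gramDev β G ≤
        κ + (4 / ε ^ 2 + 2) * (1 + Lg) * gramDev β G := by
      have h1 : (4 / ε ^ 2 + 2) * (1 + Lg) * gramDev β G =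
        4 * (1 + Lg) * (gramDev β G / ε ^ 2) + 2 * gramDev β G + 2 * Lg * gramDev β G := by
        field_simp; ring
      have h2 : 4 * (1 + Lg) * 1 ≤ 4 * (1 + Lg) * (gramDev β G / ε ^ 2) := by gcongr
      have h3 : 0 ≤ 2 * Lg * gramDev β G := by positivity
      rw [h1]; linarith
    refine le_trans ?_ hfin
    rw [abs_le]
    constructor <;> linarith

lemma tendsto_one_add_logb_div {a : ℝ} (ha : 0 ≤ a) :
    Tendsto (fun M : ℕ => (1 + Real.logb 2 (1 + a * M)) / M) atTop (𝓝 0) := by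
  have h1 : Tendsto (fun x : ℝ => Real.log x / x) atTop (𝓝 0) := by
    simpa using Real.isLittleO_log_id_atTop.tendsto_div_nhds_zero
  have h2 : Tendsto (fun M : ℕ => Real.log (M : ℝ) / M) atTop (𝓝 0) :=
    h1.comp tendsto_natCast_atTop_atTop
  have h3 : Tendsto (fun M : ℕ => (1 : ℝ) / M) atTop (𝓝 0) := tendsto_one_div_atTop_nhds_zero_nat
  have h4 : Tendsto (fun M : ℕ => (1 + Real.log (1 + a) / Real.log 2) * ((1 : ℝ) / M) +
      (Real.log (M : ℝ) / M) / Real.log 2) atTop (𝓝 0) := by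
    simpa using (h3.const_mul (1 + Real.log (1 + a) / Real.log 2)).add (h2.div_const (Real.log 2))
  refine squeeze_zero' ?_ ?_ h4
  · filter_upwards with M
    have : 0 ≤ Real.logb 2 (1 + a * M) := Real.logb_nonneg one_lt_two (by
      have : 0 ≤ a * M := by positivity
      linarith)
    positivity
  · filter_upwards [eventually_gt_atTop 0] with M hM
    have hM' : (1 : ℝ) ≤ M := by exact_mod_cast hM
    have hl2 := Real.log_pos one_lt_two
    have h5 : Real.log (1 + a * M) ≤ Real.log (1 + a) + Real.log M := by
      rw [← Real.log_mul (by positivity) (by positivity)]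
      exact Real.log_le_log (by positivity) (by nlinarith)
    rw [Real.logb]
    have e : (1 + Real.log (1 + a) / Real.log 2) * ((1 : ℝ) / M) +
      (Real.log (M : ℝ) / M) / Real.log 2 =
      (1 + (Real.log (1 + a) + Real.log M) / Real.log 2) / M := by field_simp; ring
    rw [e]
    gcongr

/-- A function of the channel that is controlled by the deviation of the Gram matrix, with only a
logarithmic loss in the number of antennas, has the expected limit. -/
lemma tendsto_integral_channelLaw_sub {β : ℝ} (hβ : 0 < β) (K : ℕ) {a : ℝ} (ha : 0 ≤ a)
    (f : ∀ M : ℕ, (Fin K → Fin M → ℂ) → ℝ) (hf : ∀ M, Measurable (f M)) (t : ℕ → ℝ)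
    (h : ∀ κ > 0, ∃ C, 0 ≤ C ∧ ∀ M : ℕ, 0 < M → ∀ G,
      |f M G - t M| ≤ κ + C * (1 + Real.logb 2 (1 + a * M)) * gramDev β G) :
    (∀ M : ℕ, 0 < M → Integrable (f M) (channelLaw β K M)) ∧
      Tendsto (fun M : ℕ => ∫ G, f M G ∂(channelLaw β K M) - t M) atTop (𝓝 0) := by
  obtain ⟨V, hV0, hV⟩ := integral_gramDev_le hβ K
  have hint : ∀ M : ℕ, 0 < M → Integrable (fun G => f M G - t M) (channelLaw β K M) :=
    fun M hM => by
      obtain ⟨C, hC0, hC⟩ := h 1 one_pos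
      exact ((integrable_const 1).add ((hV M hM).1.const_mul _)).mono'
        ((hf M).sub_const _).aestronglyMeasurable (ae_of_all _ fun G => hC M hM G)
  have hint' : ∀ M : ℕ, 0 < M → Integrable (f M) (channelLaw β K M) := fun M hM => by
    exact ((hint M hM).add (integrable_const (t M))).congr (ae_of_all _ fun G => by simp)
  refine ⟨hint', ?_⟩
  rw [Metric.tendsto_atTop']
  intro e he
  obtain ⟨C, hC0, hC⟩ := h (e / 2) (by positivity)
  have hlim : Tendsto (fun M : ℕ => C * V * ((1 + Real.logb 2 (1 + a * M)) / M)) atTop (𝓝 0) := by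
    simpa using (tendsto_one_add_logb_div ha).const_mul (C * V)
  have hev := (hlim.eventually (gt_mem_nhds (show (0 : ℝ) < e / 2 by positivity))).and
    (eventually_gt_atTop 0)
  obtain ⟨N, hN⟩ := eventually_atTop.1 hev
  refine ⟨N, fun M hM => ?_⟩
  obtain ⟨h1, hM0⟩ := hN M hM.le
  have hL0 : 0 ≤ Real.logb 2 (1 + a * M) := Real.logb_nonneg one_lt_two (by
    have : 0 ≤ a * M := by positivity
    linarith)
  have hM' : (0 : ℝ) < M := by exact_mod_cast hM0
  rw [dist_zero_right, Real.norm_eq_abs]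
  have h2 : ∫ G, f M G ∂(channelLaw β K M) - t M = ∫ G, (f M G - t M) ∂(channelLaw β K M) := by
    rw [integral_sub (hint' M hM0) (integrable_const _)]; simp
  rw [h2]
  calc |∫ G, (f M G - t M) ∂(channelLaw β K M)|
      ≤ ∫ G, |f M G - t M| ∂(channelLaw β K M) := abs_integral_le_integral_abs
    _ ≤ ∫ G, (e / 2 + C * (1 + Real.logb 2 (1 + a * M)) * gramDev β G) ∂(channelLaw β K M) :=
        integral_mono (hint M hM0).abs
          ((integrable_const _).add ((hV M hM0).1.const_mul _)) fun G => hC M hM0 G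
    _ = e / 2 + C * (1 + Real.logb 2 (1 + a * M)) * ∫ G, gramDev β G ∂(channelLaw β K M) := by
        rw [integral_add (integrable_const _) ((hV M hM0).1.const_mul _), integral_const_mul]
        simp
    _ ≤ e / 2 + C * (1 + Real.logb 2 (1 + a * M)) * (V / M) := by
        gcongr
        exact (hV M hM0).2
    _ = e / 2 + C * V * ((1 + Real.logb 2 (1 + a * M)) / M) := by ring
    _ < e := by linarith

/-! ### Logarithmic asymptotics -/

lemma tendsto_logb_natCast : Tendsto (fun M : ℕ => Real.logb 2 (M : ℝ)) atTop atTop :=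
  (Real.tendsto_logb_atTop one_lt_two).comp tendsto_natCast_atTop_atTop

lemma tendsto_logb_one_add_sub {x : ℕ → ℝ} {c : ℝ} (hc : 0 < c)
    (hx : Tendsto (fun M : ℕ => x M / M) atTop (𝓝 c)) :
    Tendsto (fun M : ℕ => Real.logb 2 (1 + x M) - Real.logb 2 M) atTop (𝓝 (Real.logb 2 c)) := by
  have h1 : Tendsto (fun M : ℕ => (1 + x M) / M) atTop (𝓝 c) := by
    simpa [add_div] using (tendsto_one_div_atTop_nhds_zero_nat (𝕜 := ℝ)).add hx
  have h2 : Tendsto (fun M : ℕ => Real.logb 2 ((1 + x M) / M)) atTop (𝓝 (Real.logb 2 c)) :=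
    ((Real.continuousAt_log hc.ne').tendsto.comp h1).div_const _
  refine h2.congr' ?_
  filter_upwards [h1.eventually (lt_mem_nhds hc), eventually_gt_atTop 0] with M hM hM0
  have hM' : (0 : ℝ) < M := by exact_mod_cast hM0
  have : 0 < 1 + x M := by
    by_contra h
    exact absurd hM (not_lt.2 (div_nonpos_of_nonpos_of_nonneg (not_lt.1 h) hM'.le))
  exact Real.logb_div this.ne' hM'.ne'

lemma tendsto_logb_mul_div_sub_one {a b : ℕ → ℝ} {x y : ℝ}
    (ha : Tendsto (fun M : ℕ => a M - Real.logb 2 M) atTop (𝓝 x))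
    (hb : Tendsto (fun M : ℕ => b M - Real.logb 2 M) atTop (𝓝 y)) :
    Tendsto (fun M : ℕ => Real.logb 2 M * (a M / b M - 1)) atTop (𝓝 (x - y)) := by
  have h1 : Tendsto (fun M : ℕ => (b M - Real.logb 2 M) / Real.logb 2 M + 1) atTop (𝓝 1) := by
    simpa using (hb.div_atTop tendsto_logb_natCast).add_const 1
  have h2 := (ha.sub hb).mul (h1.inv₀ one_ne_zero)
  simp only [inv_one, mul_one] at h2
  refine h2.congr' ?_
  filter_upwards [tendsto_logb_natCast.eventually_gt_atTop 0,
    h1.eventually (lt_mem_nhds one_pos)] with M hM hb1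
  have e : (b M - Real.logb 2 M) / Real.logb 2 M + 1 = b M / Real.logb 2 M := by
    field_simp; ring
  rw [e] at hb1 ⊢
  have hb0 : b M ≠ 0 := by rintro h; rw [h] at hb1; simp at hb1
  field_simp
  ring

lemma isLittleO_one_div_logb {f g : ℕ → ℝ} {c : ℝ}
    (hf : Tendsto (fun M : ℕ => Real.logb 2 M * f M) atTop (𝓝 c))
    (hg : Tendsto (fun M : ℕ => Real.logb 2 M * g M) atTop (𝓝 c)) :
    (fun M : ℕ => f M - g M) =o[atTop] fun M : ℕ => 1 / Real.logb 2 M := by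
  rw [Asymptotics.isLittleO_iff_tendsto']
  · have h := hf.sub hg
    rw [sub_self] at h
    refine h.congr fun M => ?_
    rw [div_div_eq_mul_div, div_one]; ring
  · filter_upwards [tendsto_logb_natCast.eventually_gt_atTop 0] with M hM h0
    exact absurd h0 (one_div_pos.2 hM).ne'

/-- The limit of `R - log₂ M` when the rate `R` is served to users of total cost `S`. -/
def rateOffset (P β N₀ S : ℝ) : ℝ := Real.logb 2 (P * β / N₀ * (1 / S))

lemma tendsto_logb_one_add_mul_div_sub {P β N₀ S : ℝ} (hP : 0 < P) (hβ : 0 < β) (hN₀ : 0 < N₀)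
    (hS : 0 < S) (n : ℕ) :
    Tendsto (fun M : ℕ => Real.logb 2 (1 + P * β / N₀ * (((M : ℝ) - n) / S)) - Real.logb 2 M) atTop
      (𝓝 (rateOffset P β N₀ S)) := by
  refine tendsto_logb_one_add_sub (by positivity) ?_
  have h1 : Tendsto (fun M : ℕ => P * β / N₀ * (1 / S) * (1 - n * (1 / (M : ℝ)))) atTop
      (𝓝 (P * β / N₀ * (1 / S) * (1 - n * 0))) :=
    (((tendsto_one_div_atTop_nhds_zero_nat (𝕜 := ℝ)).const_mul (n : ℝ)).const_sub 1).const_mul _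
  simp only [mul_zero, sub_zero, mul_one] at h1
  refine h1.congr' ?_
  filter_upwards [eventually_gt_atTop 0] with M hM
  have hM' : (0 : ℝ) < M := by exact_mod_cast hM
  field_simp

/-! ### All users in one block -/

lemma reportScale_pos {δ : ℝ} (hδ₀ : 0 < δ) (KM : ℕ) {K : ℕ} (k : Fin K) :
    0 < reportScale δ KM k := by
  unfold reportScale; split_ifs <;> linarith

lemma reportScale_le_one {δ : ℝ} (hδ₁ : δ < 1) (KM : ℕ) {K : ℕ} (k : Fin K) :
    reportScale δ KM k ≤ 1 := by
  unfold reportScale; split_ifs <;> linarith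

lemma sum_ite_val_lt {n k : ℕ} (h : k ≤ n) (a b : ℝ) :
    (∑ i : Fin n, if i.val < k then a else b) = k * a + ((n : ℝ) - k) * b := by
  rw [Fin.sum_univ_eq_sum_range (fun i => if i < k then a else b) n,
    ← Finset.sum_range_add_sum_Ico _ h,
    Finset.sum_congr rfl fun i hi => if_pos (Finset.mem_range.1 hi),
    Finset.sum_congr rfl fun i hi => if_neg (not_lt.2 (Finset.mem_Ico.1 hi).1)]
  simp [Nat.cast_sub h]

lemma sum_ite_le_val {n k : ℕ} (h : k ≤ n) (a b : ℝ) :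
    (∑ i : Fin n, if n - k ≤ i.val then a else b) = k * a + ((n : ℝ) - k) * b := by
  have h1 := sum_ite_val_lt (Nat.sub_le n k) b a
  rw [Nat.cast_sub h] at h1
  simp_rw [← not_lt, ite_not]
  rw [h1]; ring

lemma sum_one_div_reportScale {n KM : ℕ} (h : KM ≤ n) (δ : ℝ) :
    ∑ j : Fin n, 1 / reportScale δ KM j = (n : ℝ) - KM + KM / δ := by
  have h1 := sum_ite_val_lt h (1 / δ) 1
  simp only [reportScale, apply_ite (fun x : ℝ => 1 / x), one_div_one]
  rw [h1]; ring

lemma integrable_blockRate {P β N₀ : ℝ} (hP : 0 < P) (hβ : 0 < β) (hN₀ : 0 < N₀) {n : ℕ}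
    (hn : 0 < n) {s : Fin n → ℝ} (hs : ∀ j, 0 < s j) (hs1 : ∀ j, s j ≤ 1) {M : ℕ} (hM : 0 < M) :
    Integrable (fun G : Fin n → Fin M → ℂ => blockRate P N₀ s G) (channelLaw β n M) :=
  (tendsto_integral_channelLaw_sub hβ n (a := P * β / N₀) (by positivity)
    (fun M G => blockRate P N₀ s G) (fun M => measurable_blockRate P N₀ s)
    (fun M => Real.logb 2 (1 + P * β / N₀ * (M / ∑ j, 1 / s j))) fun κ hκ => by
      obtain ⟨C, hC0, hC⟩ := exists_abs_blockRate_sub_le hP hβ hN₀ hn hκ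
      exact ⟨C, hC0, fun M hM G => hC n M hM id Function.injective_id s hs hs1 G⟩).1 M hM

lemma tendsto_integral_blockRate_sub {P β N₀ : ℝ} (hP : 0 < P) (hβ : 0 < β) (hN₀ : 0 < N₀) {n : ℕ}
    (hn : 0 < n) {s : Fin n → ℝ} (hs : ∀ j, 0 < s j) (hs1 : ∀ j, s j ≤ 1) :
    Tendsto (fun M : ℕ => ∫ G, blockRate P N₀ s G ∂(channelLaw β n M) - Real.logb 2 M) atTop
      (𝓝 (rateOffset P β N₀ (∑ j, 1 / s j))) := by
  have h := (tendsto_integral_channelLaw_sub hβ n (a := P * β / N₀) (by positivity)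
    (fun M G => blockRate P N₀ s G) (fun M => measurable_blockRate P N₀ s)
    (fun M => Real.logb 2 (1 + P * β / N₀ * (M / ∑ j, 1 / s j))) fun κ hκ => by
      obtain ⟨C, hC0, hC⟩ := exists_abs_blockRate_sub_le hP hβ hN₀ hn hκ
      exact ⟨C, hC0, fun M hM G => hC n M hM id Function.injective_id s hs hs1 G⟩).2
  have : Nonempty (Fin n) := ⟨⟨0, hn⟩⟩
  have hS : 0 < ∑ j, 1 / s j :=
    Finset.sum_pos (fun j _ => one_div_pos.2 (hs j)) Finset.univ_nonempty
  have h2 := h.add (tendsto_logb_one_add_mul_div_sub hP hβ hN₀ hS 0)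
  rw [zero_add] at h2
  refine h2.congr fun M => ?_
  simp

lemma singleBlockRate_eq {P : ℝ} (hP : 0 < P) (β N₀ : ℝ) {δ : ℝ} (hδ₀ : 0 < δ) {n KM : ℕ}
    (h : KM < n) (M : ℕ) :
    singleBlockRate P β N₀ δ n KM M =
      ∫ G, blockRate P N₀ (reportScale δ KM) G ∂(channelLaw β n M) := by
  unfold singleBlockRate
  congr 1
  funext G
  have h1 : ∀ k : Fin n, (if k.val < KM then 0 else
      rate P N₀ (Matrix.of G) (Matrix.of (reported δ KM G)) k) =
      if k.val < KM then 0 else blockRate P N₀ (reportScale δ KM) G := fun k => by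
    split_ifs with hk
    · rfl
    · exact rate_eq_blockRate hP.le N₀ (reportScale_pos hδ₀ KM) G (by simp [reportScale, hk])
  have h2 : ((n : ℝ) - KM) ≠ 0 := by
    rw [sub_ne_zero]; exact_mod_cast h.ne'
  rw [Finset.sum_congr rfl fun k _ => h1 k, sum_ite_val_lt h.le]
  field_simp
  ring

lemma tendsto_singleBlockRate_sub {P β N₀ δ : ℝ} (hP : 0 < P) (hβ : 0 < β) (hN₀ : 0 < N₀)
    (hδ₀ : 0 < δ) (hδ₁ : δ < 1) {n KM : ℕ} (h : KM < n) :
    Tendsto (fun M : ℕ => singleBlockRate P β N₀ δ n KM M - Real.logb 2 M) atTop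
      (𝓝 (rateOffset P β N₀ ((n : ℝ) - KM + KM / δ))) := by
  simp_rw [singleBlockRate_eq hP β N₀ hδ₀ h]
  rw [← sum_one_div_reportScale h.le δ]
  exact tendsto_integral_blockRate_sub hP hβ hN₀ (by omega) (reportScale_pos hδ₀ KM)
    (reportScale_le_one hδ₁ KM)

lemma totalCost_pos {δ : ℝ} (hδ₀ : 0 < δ) {n KM : ℕ} (hn : 0 < n) (h : KM ≤ n) :
    0 < (n : ℝ) - KM + KM / δ := by
  have h1 : (KM : ℝ) ≤ n := by exact_mod_cast h
  rcases Nat.eq_zero_or_pos KM with h0 | h0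
  · subst h0; simpa using hn
  · have : (0 : ℝ) < KM := by exact_mod_cast h0
    have : 0 < (KM : ℝ) / δ := by positivity
    linarith

lemma tendsto_logb_mul_asympSingleBlockLoss {P β N₀ δ : ℝ} (hP : 0 < P) (hβ : 0 < β) (hN₀ : 0 < N₀)
    (hδ₀ : 0 < δ) {n KM : ℕ} (hn : 0 < n) (h : KM ≤ n) :
    Tendsto (fun M : ℕ => Real.logb 2 M * asympSingleBlockLoss P β N₀ δ n KM M) atTop
      (𝓝 (rateOffset P β N₀ n - rateOffset P β N₀ ((n : ℝ) - KM + KM / δ))) := by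
  have hn' : (0 : ℝ) < n := by exact_mod_cast hn
  have h1 := (tendsto_logb_mul_div_sub_one
    (tendsto_logb_one_add_mul_div_sub hP hβ hN₀ (totalCost_pos hδ₀ hn h) n)
    (tendsto_logb_one_add_mul_div_sub hP hβ hN₀ hn' n)).neg
  rw [neg_sub] at h1
  refine h1.congr fun M => ?_
  unfold asympSingleBlockLoss
  ring

lemma tendsto_logb_mul_loss {a b : ℕ → ℝ} {x y : ℝ}
    (ha : Tendsto (fun M : ℕ => a M - Real.logb 2 M) atTop (𝓝 x))
    (hb : Tendsto (fun M : ℕ => b M - Real.logb 2 M) atTop (𝓝 y)) :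
    Tendsto (fun M : ℕ => Real.logb 2 M * ((b M - a M) / b M)) atTop (𝓝 (y - x)) := by
  have h := (tendsto_logb_mul_div_sub_one ha hb).neg
  rw [neg_sub] at h
  refine h.congr' ?_
  have hb1 : Tendsto b atTop atTop := by
    have := tendsto_logb_natCast.atTop_add hb
    simpa using this
  filter_upwards [hb1.eventually_gt_atTop 0] with M hM
  field_simp
  ring

lemma singleBlockLoss_sub_isLittleO {P β N₀ δ : ℝ} (hP : 0 < P) (hβ : 0 < β) (hN₀ : 0 < N₀)
    (hδ₀ : 0 < δ) (hδ₁ : δ < 1) {n KM : ℕ} (h : KM < n) :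
    (fun M : ℕ => singleBlockLoss P β N₀ δ n KM M - asympSingleBlockLoss P β N₀ δ n KM M)
      =o[atTop] fun M : ℕ => 1 / Real.logb 2 M := by
  refine isLittleO_one_div_logb ?_
    (tendsto_logb_mul_asympSingleBlockLoss hP hβ hN₀ hδ₀ (by omega) h.le)
  have h0 := tendsto_singleBlockRate_sub hP hβ hN₀ hδ₀ hδ₁ (n := n) (KM := 0) (by omega)
  simp only [Nat.cast_zero, sub_zero, zero_div, add_zero] at h0
  exact tendsto_logb_mul_loss (tendsto_singleBlockRate_sub hP hβ hN₀ hδ₀ hδ₁ h) h0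

/-! ### Random grouping -/

lemma group_injective {T KB : ℕ} (π : Equiv.Perm (Fin (T * KB))) (t : Fin T) :
    Function.Injective (group π t) := fun i j h => by
  simpa using finProdFinEquiv.injective (π.injective h)

lemma periodRate_eq {P : ℝ} (hP : 0 < P) (N₀ : ℝ) {δ : ℝ} (hδ₀ : 0 < δ) {T KB M : ℕ} (KM : ℕ)
    (π : Equiv.Perm (Fin (T * KB))) (G : Fin (T * KB) → Fin M → ℂ) :
    periodRate P N₀ δ KM π G =
      (∑ t : Fin T, ∑ i : Fin KB, if (group π t i).val < KM then 0 else
        blockRate P N₀ (fun j => reportScale δ KM (group π t j)) (fun j => G (group π t j))) /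
        (((T * KB : ℕ) : ℝ) - KM) := by
  unfold periodRate
  congr 1
  refine Finset.sum_congr rfl fun t _ => Finset.sum_congr rfl fun i _ => ?_
  split_ifs with h
  · rfl
  · exact rate_eq_blockRate hP.le N₀ (s := fun j => reportScale δ KM (group π t j))
      (fun j => reportScale_pos hδ₀ KM _) (fun j => G (group π t j)) (by simp [reportScale, h])

lemma measurable_periodRate {P : ℝ} (hP : 0 < P) (N₀ : ℝ) {δ : ℝ} (hδ₀ : 0 < δ) {T KB M : ℕ}
    (KM : ℕ) (π : Equiv.Perm (Fin (T * KB))) :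
    Measurable (fun G : Fin (T * KB) → Fin M → ℂ => periodRate P N₀ δ KM π G) := by
  simp_rw [periodRate_eq hP N₀ hδ₀]
  refine (Finset.measurable_sum _ fun t _ => Finset.measurable_sum _ fun i _ => ?_).div_const _
  split_ifs
  · exact measurable_const
  · exact (measurable_blockRate P N₀ _).comp (by fun_prop)

/-- The expected rate of a block depends only on the number of its users, and on the multiset of
their report scales. -/
lemma integral_blockRate_rows {P N₀ β : ℝ} {n K M : ℕ} {ι : Fin n → Fin K}
    (hι : Function.Injective ι) {s s' : Fin n → ℝ} (e : Equiv.Perm (Fin n))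
    (h : ∀ i, s (e i) = s' i) :
    ∫ G : Fin K → Fin M → ℂ, blockRate P N₀ s (fun i => G (ι i)) ∂(channelLaw β K M) =
      ∫ G, blockRate P N₀ s' G ∂(channelLaw β n M) := by
  have h1 : ∀ G : Fin K → Fin M → ℂ, blockRate P N₀ s (fun i => G (ι i)) =
      blockRate P N₀ s' (fun i => G (ι (e i))) := fun G => by
    rw [← blockRate_rows_perm P N₀ e s]
    simp only [h]
  simp_rw [h1]
  have hm := measurePreserving_rows β (M := M) (hι.comp e.injective)
  rw [← hm.map_eq, integral_map hm.measurable.aemeasurable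
    (measurable_blockRate P N₀ s').aestronglyMeasurable]
  rfl

lemma integral_periodRate_accurate {P β N₀ δ : ℝ} (hP : 0 < P) (hβ : 0 < β) (hN₀ : 0 < N₀)
    (hδ₀ : 0 < δ) (hδ₁ : δ < 1) {T KB M : ℕ} (hT : 0 < T) (hKB : 0 < KB) (hM : 0 < M)
    (π : Equiv.Perm (Fin (T * KB))) :
    ∫ G : Fin (T * KB) → Fin M → ℂ, periodRate P N₀ δ 0 π G ∂(channelLaw β (T * KB) M) =
      singleBlockRate P β N₀ δ KB 0 M := by
  simp_rw [periodRate_eq hP N₀ hδ₀, singleBlockRate_eq hP β N₀ hδ₀ hKB]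
  have hi : ∀ t, Integrable (fun G : Fin (T * KB) → Fin M → ℂ => blockRate P N₀
      (fun j => reportScale δ 0 (group π t j)) (fun j => G (group π t j)))
      (channelLaw β (T * KB) M) := fun t =>
    (measurePreserving_rows β (group_injective π t)).integrable_comp_of_integrable
      (integrable_blockRate hP hβ hN₀ hKB (fun j => reportScale_pos hδ₀ 0 _)
        (fun j => reportScale_le_one hδ₁ 0 _) hM)
  have hv : ∀ t, ∫ G : Fin (T * KB) → Fin M → ℂ, blockRate P N₀
      (fun j => reportScale δ 0 (group π t j)) (fun j => G (group π t j))
      ∂(channelLaw β (T * KB) M) =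
      ∫ G, blockRate P N₀ (reportScale δ 0) G ∂(channelLaw β KB M) := fun t =>
    integral_blockRate_rows (group_injective π t) (Equiv.refl _) (by simp [reportScale])
  simp only [not_lt_zero, if_false, Nat.cast_zero, sub_zero]
  rw [integral_div, integral_finsetSum _ fun t _ => integrable_finsetSum _ fun i _ => hi t]
  simp_rw [integral_finsetSum _ fun i _ => hi _, hv]
  have : (T : ℝ) ≠ 0 := by exact_mod_cast hT.ne'
  have : (KB : ℝ) ≠ 0 := by exact_mod_cast hKB.ne'
  simp
  field_simp

/-- With a single misreporting user, only the honest users in the same block are affected. -/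
lemma integral_periodRate_one {P β N₀ δ : ℝ} (hP : 0 < P) (hβ : 0 < β) (hN₀ : 0 < N₀)
    (hδ₀ : 0 < δ) (hδ₁ : δ < 1) {T KB M : ℕ} (hT : 0 < T) (hKB : 0 < KB) (hM : 0 < M)
    (π : Equiv.Perm (Fin (T * KB))) :
    ∫ G : Fin (T * KB) → Fin M → ℂ, periodRate P N₀ δ 1 π G ∂(channelLaw β (T * KB) M) =
      (((KB : ℝ) - 1) * ∫ G, blockRate P N₀ (reportScale δ 1) G ∂(channelLaw β KB M) +
        ((T : ℝ) - 1) * KB * singleBlockRate P β N₀ δ KB 0 M) / ((T : ℝ) * KB - 1) := by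
  simp_rw [periodRate_eq hP N₀ hδ₀, singleBlockRate_eq hP β N₀ hδ₀ hKB]
  have hi : ∀ t, Integrable (fun G : Fin (T * KB) → Fin M → ℂ => blockRate P N₀
      (fun j => reportScale δ 1 (group π t j)) (fun j => G (group π t j)))
      (channelLaw β (T * KB) M) := fun t =>
    (measurePreserving_rows β (group_injective π t)).integrable_comp_of_integrable
      (integrable_blockRate hP hβ hN₀ hKB (fun j => reportScale_pos hδ₀ 1 _)
        (fun j => reportScale_le_one hδ₁ 1 _) hM)
  have hK : 0 < T * KB := Nat.mul_pos hT hKB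
  obtain ⟨⟨t₀, i₀⟩, h₀⟩ := finProdFinEquiv.surjective (π.symm ⟨0, hK⟩)
  have hgrp : ∀ t i, (group π t i).val < 1 ↔ t = t₀ ∧ i = i₀ := fun t i => by
    have h1 : (group π t i).val < 1 ↔ group π t i = ⟨0, hK⟩ := by
      rw [Nat.lt_one_iff, Fin.ext_iff]
    rw [h1, group, ← Equiv.eq_symm_apply, ← h₀, finProdFinEquiv.injective.eq_iff, Prod.mk.injEq]
  set B₀ := ∫ G, blockRate P N₀ (reportScale δ 0) G ∂(channelLaw β KB M)
  set B₁ := ∫ G, blockRate P N₀ (reportScale δ 1) G ∂(channelLaw β KB M)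
  have hv : ∀ t, ∫ G : Fin (T * KB) → Fin M → ℂ, blockRate P N₀
      (fun j => reportScale δ 1 (group π t j)) (fun j => G (group π t j))
      ∂(channelLaw β (T * KB) M) = if t = t₀ then B₁ else B₀ := fun t => by
    split_ifs with ht
    · refine integral_blockRate_rows (group_injective π t) (Equiv.swap ⟨0, hKB⟩ i₀) fun i => ?_
      simp only [reportScale, hgrp, ht, true_and]
      have : Equiv.swap ⟨0, hKB⟩ i₀ i = i₀ ↔ i.val < 1 := by
        rw [Equiv.swap_apply_eq_iff, Equiv.swap_apply_right, Fin.ext_iff, Nat.lt_one_iff]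
      simp only [this]
    · exact integral_blockRate_rows (group_injective π t) (Equiv.refl _)
        (by simp [reportScale, hgrp, ht])
  have hite : ∀ t i, (fun G : Fin (T * KB) → Fin M → ℂ => if (group π t i).val < 1 then 0 else
      blockRate P N₀ (fun j => reportScale δ 1 (group π t j)) (fun j => G (group π t j))) =
      fun G => (if (group π t i).val < 1 then 0 else 1) *
        blockRate P N₀ (fun j => reportScale δ 1 (group π t j)) (fun j => G (group π t j)) :=
    fun t i => by
      funext G; split_ifs <;> simp
  have hi' : ∀ t i, Integrable (fun G : Fin (T * KB) → Fin M → ℂ =>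
      if (group π t i).val < 1 then 0 else
      blockRate P N₀ (fun j => reportScale δ 1 (group π t j)) (fun j => G (group π t j)))
      (channelLaw β (T * KB) M) := fun t i => by
    rw [hite]; exact (hi t).const_mul _
  rw [integral_div, integral_finsetSum _ fun t _ => integrable_finsetSum _ fun i _ => hi' t i]
  simp_rw [integral_finsetSum _ fun i _ => hi' _ i, hite, integral_const_mul, hv, hgrp]
  have hsum : (∑ t : Fin T, ∑ i : Fin KB, (if t = t₀ ∧ i = i₀ then (0 : ℝ) else 1) *
      if t = t₀ then B₁ else B₀) = ((KB : ℝ) - 1) * B₁ + ((T : ℝ) - 1) * KB * B₀ := by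
    have h1 : ∀ t, (∑ i : Fin KB, (if t = t₀ ∧ i = i₀ then (0 : ℝ) else 1) *
        if t = t₀ then B₁ else B₀) =
        KB * B₀ + if t = t₀ then ((KB : ℝ) - 1) * B₁ - KB * B₀ else 0 := fun t => by
      by_cases ht : t = t₀
      · have h2 : ∀ i : Fin KB, (if i = i₀ then (0 : ℝ) else 1) * B₁ =
            B₁ - if i = i₀ then B₁ else 0 := fun i => by split_ifs <;> simp
        simp only [ht, true_and, if_true, h2, Finset.sum_sub_distrib, Finset.sum_ite_eq',
          Finset.mem_univ]
        simp
        ring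
      · simp [ht]
    simp only [h1, Finset.sum_add_distrib, Finset.sum_ite_eq', Finset.mem_univ, if_true]
    simp
    ring
  rw [hsum]
  push_cast
  rfl

lemma lossRand_one {P β N₀ δ : ℝ} (hP : 0 < P) (hβ : 0 < β) (hN₀ : 0 < N₀)
    (hδ₀ : 0 < δ) (hδ₁ : δ < 1) {T KB M : ℕ} (hT : 0 < T) (hKB : 0 < KB) (hK : 1 < T * KB)
    (hM : 0 < M) :
    lossRand P β N₀ δ T KB 1 M =
      ((KB : ℝ) - 1) / (T * KB - 1) * singleBlockLoss P β N₀ δ KB 1 M := by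
  have hc : (Fintype.card (Equiv.Perm (Fin (T * KB))) : ℝ) ≠ 0 := by
    exact_mod_cast Fintype.card_ne_zero
  have h0 : rateRand P β N₀ δ T KB 0 M = singleBlockRate P β N₀ δ KB 0 M := by
    unfold rateRand
    simp_rw [integral_periodRate_accurate hP hβ hN₀ hδ₀ hδ₁ hT hKB hM]
    rw [Finset.sum_const, Finset.card_univ, nsmul_eq_mul]
    field_simp
  have h1 : rateRand P β N₀ δ T KB 1 M = (((KB : ℝ) - 1) *
      ∫ G, blockRate P N₀ (reportScale δ 1) G ∂(channelLaw β KB M) +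
        ((T : ℝ) - 1) * KB * singleBlockRate P β N₀ δ KB 0 M) / ((T : ℝ) * KB - 1) := by
    unfold rateRand
    simp_rw [integral_periodRate_one hP hβ hN₀ hδ₀ hδ₁ hT hKB hM]
    rw [Finset.sum_const, Finset.card_univ, nsmul_eq_mul]
    field_simp
  have hK' : (T : ℝ) * KB - 1 ≠ 0 := by
    rw [sub_ne_zero]; exact_mod_cast hK.ne'
  unfold lossRand singleBlockLoss
  rw [h0, h1]
  rcases Nat.lt_or_ge 1 KB with h | h
  · rw [singleBlockRate_eq hP β N₀ hδ₀ h, ← mul_div_assoc]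
    congr 1
    rw [show ((T : ℝ) - 1) * KB = (T * KB - 1) - (KB - 1) by ring]
    generalize (T : ℝ) * KB - 1 = d at hK'
    field_simp
    ring
  · have : KB = 1 := by omega
    subst this
    have hK'' : (T : ℝ) - 1 ≠ 0 := by simpa using hK'
    simp [mul_div_cancel_left₀ _ hK'']

/-! ### Channel-magnitude grouping -/

lemma measurableSet_sort_eq {Ω : Type*} [MeasurableSpace Ω] {n : ℕ} {f : Ω → Fin n → ℝ}
    (hf : Measurable f) (σ : Equiv.Perm (Fin n)) :
    MeasurableSet {ω | Tuple.sort (f ω) = σ} := by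
  have e : {ω | Tuple.sort (f ω) = σ} = {ω | (∀ i j, i ≤ j → f ω (σ i) ≤ f ω (σ j)) ∧
      ∀ i j, i < j → f ω (σ i) = f ω (σ j) → σ i < σ j} := by
    ext ω
    simp only [Set.mem_ofPred_eq]
    rw [eq_comm, Tuple.eq_sort_iff]
    rfl
  have hm : ∀ i, Measurable fun ω => f ω i := fun i => (measurable_pi_apply i).comp hf
  rw [e, Set.ofPred_and]
  refine MeasurableSet.inter ?_ ?_
  · simp only [Set.ofPred_forall]
    exact MeasurableSet.iInter fun i => MeasurableSet.iInter fun j => MeasurableSet.iInter fun _ =>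
      measurableSet_le (hm _) (hm _)
  · simp only [Set.ofPred_forall]
    exact MeasurableSet.iInter fun i => MeasurableSet.iInter fun j => MeasurableSet.iInter fun _ =>
      (measurableSet_eq_fun (hm _) (hm _)).imp (MeasurableSet.const _)

lemma measurable_apply_of_finite {Ω α β : Type*} [MeasurableSpace Ω] [MeasurableSpace β]
    [Finite α] {g : Ω → α} (hg : ∀ a, MeasurableSet {ω | g ω = a}) {f : α → Ω → β}
    (hf : ∀ a, Measurable (f a)) : Measurable fun ω => f (g ω) ω := by
  intro s hs
  have e : (fun ω => f (g ω) ω) ⁻¹' s = ⋃ a, {ω | g ω = a} ∩ f a ⁻¹' s := by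
    ext ω
    simp
  rw [e]
  exact MeasurableSet.iUnion fun a => (hg a).inter (hf a hs)

lemma channelMagnitude_reported {δ : ℝ} (hδ₀ : 0 < δ) (KM : ℕ) {K M : ℕ} (G : Fin K → Fin M → ℂ)
    (k : Fin K) :
    channelMagnitude (reported δ KM G) k = reportScale δ KM k * ∑ m, ‖G k m‖ ^ 2 := by
  simp only [channelMagnitude, reported, Finset.mul_sum]
  refine Finset.sum_congr rfl fun m _ => ?_
  rw [norm_mul, mul_pow, Complex.norm_real, Real.norm_eq_abs, sq_abs,
    Real.sq_sqrt (reportScale_pos hδ₀ KM k).le]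

lemma measurable_periodRate_magnitudeOrder {P : ℝ} (hP : 0 < P) (N₀ : ℝ) {δ : ℝ} (hδ₀ : 0 < δ)
    {T KB M : ℕ} (KM : ℕ) :
    Measurable (fun G : Fin (T * KB) → Fin M → ℂ =>
      periodRate P N₀ δ KM (magnitudeOrder (reported δ KM G)) G) := by
  refine measurable_apply_of_finite (g := fun G => magnitudeOrder (reported δ KM G))
    (f := fun π G => periodRate P N₀ δ KM π G) (fun σ => ?_)
    fun π => measurable_periodRate hP N₀ hδ₀ KM π
  refine measurableSet_sort_eq (f := fun G k => -channelMagnitude (reported δ KM G) k)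
    (measurable_pi_iff.2 fun k => ?_) σ
  simp_rw [channelMagnitude_reported hδ₀]
  fun_prop

/-- If every misreporting user reports less than every honest one, the misreporting users come
last. -/
lemma magnitudeOrder_val_lt_iff {K KM M : ℕ} (hKM : KM ≤ K) {F : Fin K → Fin M → ℂ}
    (h : ∀ k l : Fin K, k.val < KM → KM ≤ l.val → channelMagnitude F k < channelMagnitude F l)
    (p : Fin K) : (magnitudeOrder F p).val < KM ↔ K - KM ≤ p.val := by
  set σ := magnitudeOrder F
  have hmono : Monotone ((fun k => -channelMagnitude F k) ∘ σ) := Tuple.monotone_sort _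
  -- the positions of the misreporting users form an upper set with `KM` elements
  have hup : ∀ p q : Fin K, p ≤ q → (σ p).val < KM → (σ q).val < KM := by
    intro p q hpq hp
    by_contra hq
    have h1 := h _ _ hp (not_lt.1 hq)
    have h2 : -channelMagnitude F (σ p) ≤ -channelMagnitude F (σ q) := hmono hpq
    linarith
  set A : Finset (Fin K) := Finset.univ.filter fun p => (σ p).val < KM with hA
  have hAcard : A.card = KM := by
    have h1 : A.map σ.toEmbedding = Finset.univ.filter fun k : Fin K => k.val < KM := by
      ext k
      simp only [hA, Finset.mem_map, Finset.mem_filter, Finset.mem_univ, true_and,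
        Equiv.coe_toEmbedding]
      exact ⟨by rintro ⟨p, hp, rfl⟩; exact hp, fun hk => ⟨σ.symm k, by simpa using hk, by simp⟩⟩
    rw [← Finset.card_map σ.toEmbedding, h1, Fin.card_filter_val_lt, min_eq_right hKM]
  have hsub : A ⊆ Finset.univ.filter fun p : Fin K => K - KM ≤ p.val := by
    intro p hp
    have h1 : Finset.Ici p ⊆ A := fun q hq => by
      simp only [hA, Finset.mem_filter, Finset.mem_univ, true_and] at hp ⊢
      exact hup p q (Finset.mem_Ici.1 hq) hp
    have h2 := Finset.card_le_card h1
    rw [Fin.card_Ici, hAcard] at h2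
    simp only [Finset.mem_filter, Finset.mem_univ, true_and]
    omega
  have hcard : (Finset.univ.filter fun p : Fin K => K - KM ≤ p.val).card ≤ A.card := by
    have h1 := Finset.card_filter_add_card_filter_not (s := (Finset.univ : Finset (Fin K)))
      (fun p : Fin K => p.val < K - KM)
    simp only [not_lt] at h1
    rw [Fin.card_filter_val_lt, Finset.card_univ, Fintype.card_fin] at h1
    omega
  have := Finset.eq_of_subset_of_card_le hsub hcard
  have h3 := Finset.ext_iff.1 this p
  simpa [hA] using h3

/-- When the Gram matrix is close to a multiple of the identity, the misreporting users are the
last ones in the order by reported magnitude. -/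
lemma magnitudeOrder_reported_val_lt_iff {β δ : ℝ} (hβ : 0 < β) (hδ₀ : 0 < δ) (hδ₁ : δ < 1)
    {K KM M : ℕ} (hKM : KM ≤ K) (hM : 0 < M) {G : Fin K → Fin M → ℂ}
    (hG : gramDev β G < ((1 - δ) / 2) ^ 2) (p : Fin K) :
    (magnitudeOrder (reported δ KM G) p).val < KM ↔ K - KM ≤ p.val := by
  refine magnitudeOrder_val_lt_iff hKM (fun k l hk hl => ?_) p
  have hM' : (0 : ℝ) < M := by exact_mod_cast hM
  rw [channelMagnitude_reported hδ₀, channelMagnitude_reported hδ₀, reportScale, if_pos hk,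
    reportScale, if_neg (not_lt.2 hl), one_mul]
  have h1 := abs_lt_of_sq_lt_sq ((abs_magnitude_sub_one_sq_le (β := β) G k).trans_lt hG)
    (by linarith)
  have h2 := abs_lt_of_sq_lt_sq ((abs_magnitude_sub_one_sq_le (β := β) G l).trans_lt hG)
    (by linarith)
  have h3 := (abs_lt.1 h1).2
  have h4 := (abs_lt.1 h2).1
  have hMβ : 0 < M * β := by positivity
  have h5 : δ * ((∑ m, ‖G k m‖ ^ 2) / (M * β)) < (∑ m, ‖G l m‖ ^ 2) / (M * β) := by
    nlinarith
  rwa [← mul_div_assoc, div_lt_div_iff_of_pos_right hMβ] at h5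

/-- The period rate when the misreporting users are served last, with the rate of a block of total
cost `S` replaced by `ρ S`. -/
lemma sum_misreporting_last (ρ : ℝ → ℝ) (δ : ℝ) {T KB KM : ℕ} (hT : 1 ≤ T) (hKM : KM ≤ KB) :
    (∑ t : Fin T, ∑ i : Fin KB,
      if T * KB - KM ≤ (finProdFinEquiv (t, i)).val then 0 else
        ρ (∑ j : Fin KB, 1 / if T * KB - KM ≤ (finProdFinEquiv (t, j)).val then δ else 1)) =
      ((T : ℝ) - 1) * KB * ρ KB + ((KB : ℝ) - KM) * ρ ((KB : ℝ) - KM + KM / δ) := by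
  obtain ⟨T, rfl⟩ : ∃ T', T = T' + 1 := ⟨T - 1, by omega⟩
  rw [Fin.sum_univ_castSucc]
  have h1 : ∀ (t : Fin T) (i : Fin KB),
      ¬ ((T + 1) * KB - KM ≤ (finProdFinEquiv (t.castSucc, i)).val) := fun t i => by
    simp only [finProdFinEquiv_apply_val, Fin.val_castSucc]
    have h2 : KB * t.val + KB ≤ KB * T := by
      rw [← Nat.mul_succ]; exact Nat.mul_le_mul_left _ t.isLt
    have h3 : (T + 1) * KB = KB * T + KB := by ring
    have := i.isLt
    omega
  have h2 : ∀ i : Fin KB,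
      (T + 1) * KB - KM ≤ (finProdFinEquiv (Fin.last T, i)).val ↔ KB - KM ≤ i.val := fun i => by
    simp only [finProdFinEquiv_apply_val, Fin.val_last]
    have h3 : (T + 1) * KB = KB * T + KB := by ring
    omega
  simp only [h1, h2, if_false]
  have h3 : (∑ j : Fin KB, 1 / if KB - KM ≤ j.val then δ else 1) =
      (KB : ℝ) - KM + KM / δ := by
    simp only [apply_ite (fun x : ℝ => 1 / x), one_div_one]
    rw [sum_ite_le_val hKM]; ring
  rw [h3, sum_ite_le_val hKM]
  simp
  ring

lemma tendsto_rateCM_sub {P β N₀ δ : ℝ} (hP : 0 < P) (hβ : 0 < β) (hN₀ : 0 < N₀)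
    (hδ₀ : 0 < δ) (hδ₁ : δ < 1) {T KB KM : ℕ} (hT : 1 ≤ T) (hKB : 1 ≤ KB) (hKM : KM ≤ KB)
    (hhonest : KM < T * KB) :
    Tendsto (fun M : ℕ => rateCM P β N₀ δ T KB KM M - Real.logb 2 M) atTop
      (𝓝 ((((T : ℝ) - 1) * KB * rateOffset P β N₀ KB +
        ((KB : ℝ) - KM) * rateOffset P β N₀ ((KB : ℝ) - KM + KM / δ)) / (T * KB - KM))) := by
  set ρ : ℕ → ℝ → ℝ := fun M S => Real.logb 2 (1 + P * β / N₀ * (M / S)) with hρ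
  have hH : (0 : ℝ) < T * KB - KM := by
    rw [sub_pos]; exact_mod_cast hhonest
  set H : ℝ := T * KB - KM with hHdef
  have hKBpos : (0 : ℝ) < KB := by exact_mod_cast hKB
  have hTpos : (0 : ℝ) < T := by exact_mod_cast hT
  have hmain := (tendsto_integral_channelLaw_sub hβ (T * KB) (a := P * β / N₀) (by positivity)
    (fun M G => periodRate P N₀ δ KM (magnitudeOrder (reported δ KM G)) G)
    (fun M => measurable_periodRate_magnitudeOrder hP N₀ hδ₀ KM)
    (fun M => (((T : ℝ) - 1) * KB * ρ M KB +
      ((KB : ℝ) - KM) * ρ M ((KB : ℝ) - KM + KM / δ)) / H) ?_).2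
  · have h1 := tendsto_logb_one_add_mul_div_sub hP hβ hN₀ hKBpos 0
    have h2 := tendsto_logb_one_add_mul_div_sub hP hβ hN₀ (totalCost_pos hδ₀ hKB hKM) 0
    have h3 := ((h1.const_mul (((T : ℝ) - 1) * KB)).add (h2.const_mul ((KB : ℝ) - KM))).div_const H
    have h4 := hmain.add h3
    rw [zero_add] at h4
    refine h4.congr fun M => ?_
    simp only [hρ, rateCM, Nat.cast_zero, sub_zero]
    have : ((T : ℝ) - 1) * KB = H - (KB - KM) := by rw [hHdef]; ring
    rw [this]
    field_simp
    ring
  · intro κ hκ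
    set N : ℝ := T * KB / H with hN
    have hN0 : 0 < N := by positivity
    obtain ⟨C, hC0, hC⟩ := exists_abs_blockRate_sub_le hP hβ hN₀ (n := KB) hKB
      (κ := κ / N) (by positivity)
    refine ⟨N * (C + 1 / ((1 - δ) / 2) ^ 2), by positivity, fun M hM G => ?_⟩
    have hM' : (0 : ℝ) < M := by exact_mod_cast hM
    set π := magnitudeOrder (reported δ KM G)
    set Lg := Real.logb 2 (1 + P * β / N₀ * M)
    have hLg0 : 0 ≤ Lg := Real.logb_nonneg one_lt_two (by
      have : 0 ≤ P * β / N₀ * M := by positivity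
      linarith)
    set D := gramDev β G with hD
    have hD0 : 0 ≤ D := gramDev_nonneg G
    set E := κ / N + C * (1 + Lg) * D with hE
    have hE0 : 0 ≤ E := by positivity
    -- the rate of a block of total cost at least one is at most that of a block of cost one
    have hρb : ∀ s : Fin KB → ℝ, (∀ j, 0 < s j) → (∀ j, s j ≤ 1) →
        0 ≤ ρ M (∑ j, 1 / s j) ∧ ρ M (∑ j, 1 / s j) ≤ Lg := fun s hs hs1 => by
      have hS1 : 1 ≤ ∑ j, 1 / s j :=
        ((one_le_div (hs ⟨0, hKB⟩)).2 (hs1 _)).trans (Finset.single_le_sum (f := fun j => 1 / s j)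
          (fun j _ => one_div_nonneg.2 (hs j).le) (Finset.mem_univ (⟨0, hKB⟩ : Fin KB)))
      set S := ∑ j, 1 / s j
      have hS0 : 0 < S := by linarith
      constructor
      · refine Real.logb_nonneg one_lt_two ?_
        have : 0 ≤ P * β / N₀ * (M / S) := by positivity
        linarith
      · refine Real.logb_le_logb_of_le one_lt_two (by positivity) ?_
        gcongr
        exact div_le_self hM'.le hS1
    have hite : ∀ (p : Prop) [Decidable p], 0 < (if p then δ else 1) ∧ (if p then δ else 1) ≤ 1 :=
      fun p _ => by split_ifs <;> constructor <;> linarith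
    have hbl : ∀ t : Fin T, ∀ i : Fin KB,
        |(if (group π t i).val < KM then 0 else
          blockRate P N₀ (fun j => reportScale δ KM (group π t j)) (fun j => G (group π t j))) -
        if T * KB - KM ≤ (finProdFinEquiv (t, i)).val then 0 else
          ρ M (∑ j : Fin KB, 1 / if T * KB - KM ≤ (finProdFinEquiv (t, j)).val then δ else 1)| ≤
        E + Lg * (D / ((1 - δ) / 2) ^ 2) := by
      intro t i
      have h1 := hC _ M hM (group π t) (group_injective π t)
        (fun j => reportScale δ KM (group π t j)) (fun j => reportScale_pos hδ₀ KM _)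
        (fun j => reportScale_le_one hδ₁ KM _) G
      have h2 := hρb (fun j => reportScale δ KM (group π t j)) (fun j => reportScale_pos hδ₀ KM _)
        (fun j => reportScale_le_one hδ₁ KM _)
      have h3 := hρb (fun j => if T * KB - KM ≤ (finProdFinEquiv (t, j)).val then δ else 1)
        (fun j => (hite _).1) (fun j => (hite _).2)
      by_cases hcase : D < ((1 - δ) / 2) ^ 2
      · have hord : ∀ j, (group π t j).val < KM ↔ T * KB - KM ≤ (finProdFinEquiv (t, j)).val :=
          fun j => magnitudeOrder_reported_val_lt_iff hβ hδ₀ hδ₁ hhonest.le hM hcase _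
        have h4 : 0 ≤ Lg * (D / ((1 - δ) / 2) ^ 2) := by positivity
        simp only [hord, reportScale] at h1 ⊢
        split_ifs
        · rw [sub_zero, abs_zero]; linarith
        · exact h1.trans (by linarith)
      · have h4 : 1 ≤ D / ((1 - δ) / 2) ^ 2 :=
          (one_le_div (by have : 0 < 1 - δ := by linarith
                          positivity)).2 (not_lt.1 hcase)
        have h5 : Lg * 1 ≤ Lg * (D / ((1 - δ) / 2) ^ 2) := by gcongr
        have h6 := blockRate_nonneg hP.le hN₀.le (fun j => reportScale_pos hδ₀ KM (group π t j))
          (fun j => G (group π t j))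
        rw [abs_le] at h1 ⊢
        obtain ⟨h1a, h1b⟩ := h1
        obtain ⟨h2a, h2b⟩ := h2
        obtain ⟨h3a, h3b⟩ := h3
        simp only [hρ] at h2a h2b h3a h3b ⊢
        split_ifs <;> constructor <;> linarith
    rw [periodRate_eq hP N₀ hδ₀, ← sum_misreporting_last (ρ M) δ hT hKM, Nat.cast_mul, ← hHdef,
      ← sub_div, abs_div, abs_of_pos hH, ← Finset.sum_sub_distrib]
    simp_rw [← Finset.sum_sub_distrib]
    have hsum := (Finset.abs_sum_le_sum_abs _ Finset.univ).trans
      (Finset.sum_le_sum fun t (_ : t ∈ Finset.univ) =>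
        (Finset.abs_sum_le_sum_abs _ Finset.univ).trans
          (Finset.sum_le_sum fun i (_ : i ∈ Finset.univ) => hbl t i))
    refine (div_le_div_of_nonneg_right hsum hH.le).trans ?_
    simp only [Finset.sum_const, Finset.card_univ, Fintype.card_fin, nsmul_eq_mul]
    have e1 : (T : ℝ) * (KB * (E + Lg * (D / ((1 - δ) / 2) ^ 2))) / H =
        κ + N * (C * (1 + Lg) * D + Lg * D / ((1 - δ) / 2) ^ 2) := by
      have : (T : ℝ) * (KB * (E + Lg * (D / ((1 - δ) / 2) ^ 2))) / H =
        N * (E + Lg * (D / ((1 - δ) / 2) ^ 2)) := by rw [hN]; ring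
      rw [this, hE]
      field_simp
      ring
    rw [e1]
    have e2 : N * (C + 1 / ((1 - δ) / 2) ^ 2) * (1 + Lg) * D =
        N * (C * (1 + Lg) * D + (1 + Lg) * D / ((1 - δ) / 2) ^ 2) := by ring
    rw [e2]
    gcongr
    linarith

lemma tendsto_logb_mul_lossCM {P β N₀ δ : ℝ} (hP : 0 < P) (hβ : 0 < β) (hN₀ : 0 < N₀)
    (hδ₀ : 0 < δ) (hδ₁ : δ < 1) {T KB KM : ℕ} (hT : 1 ≤ T) (hKB : 1 ≤ KB) (hKM : KM ≤ KB)
    (hhonest : KM < T * KB) :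
    Tendsto (fun M : ℕ => Real.logb 2 M * lossCM P β N₀ δ T KB KM M) atTop
      (𝓝 (((KB : ℝ) - KM) / (T * KB - KM) *
        (rateOffset P β N₀ KB - rateOffset P β N₀ ((KB : ℝ) - KM + KM / δ)))) := by
  have hTpos : (0 : ℝ) < T := by exact_mod_cast hT
  have hKBpos : (0 : ℝ) < KB := by exact_mod_cast hKB
  have hH : (T : ℝ) * KB - KM ≠ 0 := by
    rw [sub_ne_zero]; exact_mod_cast hhonest.ne'
  have h := tendsto_logb_mul_loss (tendsto_rateCM_sub hP hβ hN₀ hδ₀ hδ₁ hT hKB hKM hhonest)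
    (tendsto_rateCM_sub hP hβ hN₀ hδ₀ hδ₁ hT hKB (Nat.zero_le KB) (Nat.mul_pos hT hKB))
  have h' : Tendsto (fun M : ℕ => Real.logb 2 M * lossCM P β N₀ δ T KB KM M) atTop _ := h
  refine h'.trans (le_of_eq (congrArg 𝓝 ?_))
  simp only [Nat.cast_zero, sub_zero, zero_div, add_zero]
  have e : ((T : ℝ) - 1) * KB * rateOffset P β N₀ KB + KB * rateOffset P β N₀ KB =
    T * KB * rateOffset P β N₀ KB := by ring
  rw [e, mul_div_cancel_left₀ _ (by positivity)]
  rw [show ((T : ℝ) - 1) * KB = (T * KB - KM) - (KB - KM) by ring]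
  generalize (T : ℝ) * KB - KM = d at hH
  field_simp
  ring

/-! ### Order statistics of the gamma distribution -/

lemma ae_pos_gammaMeasure (a r : ℝ) : ∀ᵐ x ∂(gammaMeasure a r), 0 < x := by
  rw [gammaMeasure, ae_withDensity_iff (f := gammaPDF a r)
    (measurable_gammaPDFReal a r).ennreal_ofReal]
  filter_upwards [Measure.ae_ne volume (0 : ℝ)] with x hx h
  by_contra h'
  exact h (gammaPDF_of_neg (lt_of_le_of_ne (not_lt.1 h') hx))

lemma integral_inv_pow_gammaMeasure {a r : ℝ} (hr : 0 < r) {k : ℕ} (hk : k ≠ 0) (hak : (k : ℝ) < a) :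
    Integrable (fun x => (1 / x) ^ k) (gammaMeasure a r) ∧
      ∫ x, (1 / x) ^ k ∂(gammaMeasure a r) = r ^ k * Real.Gamma (a - k) / Real.Gamma a := by
  have hk0 : (0 : ℝ) ≤ k := Nat.cast_nonneg k
  have ha : 0 < a := by linarith
  have hG := Real.Gamma_pos_of_pos ha
  have hG' := Real.Gamma_pos_of_pos (sub_pos.2 hak)
  have hval : ∫ x, (1 / x) ^ k ∂(gammaMeasure a r) = r ^ k * Real.Gamma (a - k) / Real.Gamma a := by
    rw [gammaMeasure, integral_withDensity_eq_integral_toReal_smul (f := gammaPDF a r)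
      (measurable_gammaPDFReal a r).ennreal_ofReal (ae_of_all _ fun x => ENNReal.ofReal_lt_top),
      ← setIntegral_eq_integral_of_forall_compl_eq_zero (s := Set.Ioi 0)]
    · have e : ∀ x ∈ Set.Ioi (0 : ℝ), (gammaPDF a r x).toReal • (1 / x) ^ k =
          r ^ a / Real.Gamma a * (x ^ (a - k - 1) * Real.exp (-(r * x))) := fun x hx => by
        have hx' : (0 : ℝ) < x := hx
        rw [gammaPDF, ENNReal.toReal_ofReal (gammaPDFReal_nonneg ha hr x), gammaPDFReal,
          if_pos hx'.le, smul_eq_mul,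
          show a - k - 1 = (a - 1) - (k : ℝ) by ring, Real.rpow_sub hx' (a - 1) k,
          Real.rpow_natCast, one_div, inv_pow]
        field_simp
      rw [setIntegral_congr_fun measurableSet_Ioi e, integral_const_mul,
        Real.integral_rpow_mul_exp_neg_mul_Ioi (sub_pos.2 hak) hr, Real.div_rpow zero_le_one hr.le,
        Real.one_rpow, Real.rpow_sub hr, Real.rpow_natCast]
      have := (Real.rpow_pos_of_pos hr a).ne'
      field_simp
    · intro x hx
      rcases lt_or_eq_of_le (not_lt.1 (show ¬ 0 < x from hx)) with h | h
      · rw [gammaPDF_of_neg h]; simp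
      · rw [h]; simp [hk]
  refine ⟨Integrable.of_integral_ne_zero ?_, hval⟩
  rw [hval]
  positivity

section OrderStatistics

variable {β : ℝ} {M N : ℕ}

/-- The law of a sample of size `N` from the gamma distribution with shape `M` and scale `β`. -/
abbrev gammaSample (β : ℝ) (M N : ℕ) : Measure (Fin N → ℝ) :=
  Measure.pi fun _ => gammaMeasure (M : ℝ) (1 / β)

lemma isProbabilityMeasure_gamma (hβ : 0 < β) (hM : 0 < M) :
    IsProbabilityMeasure (gammaMeasure (M : ℝ) (1 / β)) :=
  isProbabilityMeasure_gammaMeasure (by exact_mod_cast hM) (by positivity)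

lemma integral_one_div_gamma (hβ : 0 < β) (hM : 1 < M) :
    Integrable (fun x => 1 / x) (gammaMeasure (M : ℝ) (1 / β)) ∧
      ∫ x, 1 / x ∂(gammaMeasure (M : ℝ) (1 / β)) = 1 / (β * ((M : ℝ) - 1)) := by
  have hM' : (1 : ℝ) < M := by exact_mod_cast hM
  have h := integral_inv_pow_gammaMeasure (a := M) (r := 1 / β) (by positivity) (k := 1) one_ne_zero
    (by simpa using hM')
  simp only [pow_one, Nat.cast_one] at h
  refine ⟨h.1, h.2.trans ?_⟩
  have h1 := Real.Gamma_add_one (sub_pos.2 hM').ne'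
  rw [sub_add_cancel] at h1
  have h2 := (Real.Gamma_pos_of_pos (sub_pos.2 hM')).ne'
  have h3 := (sub_pos.2 hM').ne'
  rw [h1]
  field_simp

lemma integral_one_div_sq_gamma (hβ : 0 < β) (hM : 2 < M) :
    Integrable (fun x => (1 / x) ^ 2) (gammaMeasure (M : ℝ) (1 / β)) ∧
      ∫ x, (1 / x) ^ 2 ∂(gammaMeasure (M : ℝ) (1 / β)) =
        1 / (β ^ 2 * (((M : ℝ) - 1) * ((M : ℝ) - 2))) := by
  have hM' : (2 : ℝ) < M := by exact_mod_cast hM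
  have h := integral_inv_pow_gammaMeasure (a := M) (r := 1 / β) (by positivity) (k := 2) two_ne_zero
    (by simpa using hM')
  simp only [Nat.cast_ofNat] at h
  refine ⟨h.1, h.2.trans ?_⟩
  have h0 : (0 : ℝ) < M - 1 := by linarith
  have h1 := Real.Gamma_add_one h0.ne'
  have h2 := Real.Gamma_add_one (sub_pos.2 hM').ne'
  rw [sub_add_cancel] at h1
  rw [show (M : ℝ) - 2 + 1 = M - 1 by ring] at h2
  have h3 := (Real.Gamma_pos_of_pos (sub_pos.2 hM')).ne'
  have h4 := (sub_pos.2 hM').ne'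
  rw [h1, h2]
  field_simp

/-- The relative fluctuation of `1 / x` about its mean has variance `1 / (M - 2)`. -/
lemma integral_abs_mul_one_div_sub_one_gamma_le (hβ : 0 < β) (hM : 2 < M) :
    Integrable (fun x => |β * ((M : ℝ) - 1) * (1 / x) - 1|) (gammaMeasure (M : ℝ) (1 / β)) ∧
    ∫ x, |β * ((M : ℝ) - 1) * (1 / x) - 1| ∂(gammaMeasure (M : ℝ) (1 / β)) ≤
      2 / Real.sqrt ((M : ℝ) - 2) := by
  have := isProbabilityMeasure_gamma (M := M) hβ (by omega)
  have hM' : (2 : ℝ) < M := by exact_mod_cast hM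
  obtain ⟨i1, v1⟩ := integral_one_div_gamma hβ (show 1 < M by omega)
  obtain ⟨i2, v2⟩ := integral_one_div_sq_gamma hβ hM
  set c := β * ((M : ℝ) - 1) with hc
  have hint : Integrable (fun x => |c * (1 / x) - 1|) (gammaMeasure (M : ℝ) (1 / β)) :=
    ((i1.const_mul c).sub (integrable_const 1)).abs
  refine ⟨hint, ?_⟩
  set q := Real.sqrt ((M : ℝ) - 2) with hq
  have hq0 : 0 < q := Real.sqrt_pos.2 (by linarith)
  have hqq : q ^ 2 = M - 2 := Real.sq_sqrt (by linarith)
  have hsq : ∫ x, (c * (1 / x) - 1) ^ 2 ∂(gammaMeasure (M : ℝ) (1 / β)) = 1 / q ^ 2 := by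
    have e : (fun x : ℝ => (c * (1 / x) - 1) ^ 2) =
        fun x => c ^ 2 * (1 / x) ^ 2 - 2 * c * (1 / x) + 1 := by funext x; ring
    have i3 : Integrable (fun x : ℝ => c ^ 2 * (1 / x) ^ 2 - 2 * c * (1 / x))
        (gammaMeasure (M : ℝ) (1 / β)) := (i2.const_mul _).sub (i1.const_mul _)
    rw [e, integral_add i3 (integrable_const _), integral_sub (i2.const_mul _) (i1.const_mul _),
      integral_const_mul, integral_const_mul, v1, v2, hqq, hc, integral_const, probReal_univ,
      one_smul]
    have h1 : (M : ℝ) - 2 ≠ 0 := by linarith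
    have h2 : (M : ℝ) - 1 ≠ 0 := by linarith
    field_simp
    ring
  have hisq : Integrable (fun x => (c * (1 / x) - 1) ^ 2) (gammaMeasure (M : ℝ) (1 / β)) :=
    Integrable.of_integral_ne_zero (by rw [hsq]; positivity)
  have hpt : ∀ x : ℝ, |c * (1 / x) - 1| ≤ 1 / q + q * (c * (1 / x) - 1) ^ 2 := fun x => by
    set y := c * (1 / x) - 1
    rw [← sq_abs y]
    have h1 : 1 / q + q * |y| ^ 2 - |y| = ((1 - q * |y|) ^ 2 + q * |y|) / q := by field_simp; ring
    have h2 : 0 ≤ ((1 - q * |y|) ^ 2 + q * |y|) / q := by positivity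
    linarith
  refine (integral_mono hint ((integrable_const _).add (hisq.const_mul q)) hpt).trans (le_of_eq ?_)
  rw [integral_add' (integrable_const _) (hisq.const_mul q), integral_const_mul, hsq, integral_const,
    probReal_univ, one_smul]
  field_simp
  norm_num

lemma measurable_orderStat {n : ℕ} (k : Fin n) :
    Measurable fun x : Fin n → ℝ => x (Tuple.sort x k) :=
  measurable_apply_of_finite (g := fun x : Fin n → ℝ => Tuple.sort x) (f := fun σ x => x (σ k))
    (fun σ => measurableSet_sort_eq measurable_id σ) fun σ => measurable_pi_apply (σ k)

lemma integral_orderStatLaw (k : Fin N) :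
    ∫ x, 1 / x ∂(orderStatLaw (gammaMeasure (M : ℝ) (1 / β)) N k) =
      ∫ x, 1 / x (Tuple.sort x k) ∂(gammaSample β M N) :=
  integral_map (measurable_orderStat k).aemeasurable
    (by fun_prop : Measurable fun x : ℝ => 1 / x).aestronglyMeasurable

lemma integral_one_div_coord (hβ : 0 < β) (hM : 1 < M) (i : Fin N) :
    Integrable (fun x => 1 / x i) (gammaSample β M N) ∧
      ∫ x, 1 / x i ∂(gammaSample β M N) = 1 / (β * ((M : ℝ) - 1)) := by
  have := isProbabilityMeasure_gamma (M := M) hβ (by omega)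
  obtain ⟨i1, v1⟩ := integral_one_div_gamma hβ hM
  have hm := measurePreserving_eval (fun _ : Fin N => gammaMeasure (M : ℝ) (1 / β)) i
  refine ⟨hm.integrable_comp_of_integrable i1, ?_⟩
  rw [← v1, ← hm.map_eq, integral_map hm.measurable.aemeasurable
    (by fun_prop : Measurable fun x : ℝ => 1 / x).aestronglyMeasurable]

lemma integrable_one_div_orderStat (hβ : 0 < β) (hM : 1 < M) (k : Fin N) :
    Integrable (fun x => 1 / x (Tuple.sort x k)) (gammaSample β M N) := by
  refine (integrable_finsetSum Finset.univ fun i _ =>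
    (integral_one_div_coord (N := N) hβ hM i).1.abs).mono'
    ((measurable_orderStat k).const_div 1).aestronglyMeasurable (ae_of_all _ fun x => ?_)
  rw [Real.norm_eq_abs]
  exact Finset.single_le_sum (f := fun i => |1 / x i|) (fun i _ => abs_nonneg _)
    (Finset.mem_univ (Tuple.sort x k))

lemma invOrderStatSum_eq (hβ : 0 < β) (hM : 1 < M) (n : ℕ) :
    invOrderStatSum β M N n = ∫ x, ∑ k ∈ Finset.univ.filter (fun k : Fin N => k.val < n),
      1 / x (Tuple.sort x k) ∂(gammaSample β M N) := by
  rw [integral_finsetSum _ fun k _ => integrable_one_div_orderStat hβ hM k, invOrderStatSum]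
  exact Finset.sum_congr rfl fun k _ => integral_orderStatLaw k

/-- All order statistics of a gamma sample concentrate at the mean as the shape grows. -/
lemma tendsto_mul_invOrderStatSum (hβ : 0 < β) {n : ℕ} (hn : n ≤ N) :
    Tendsto (fun M : ℕ => β * ((M : ℝ) - 1) * invOrderStatSum β M N n) atTop (𝓝 n) := by
  have hk : ∀ k : Fin N, Tendsto (fun M : ℕ => β * ((M : ℝ) - 1) *
      ∫ x, 1 / x ∂(orderStatLaw (gammaMeasure (M : ℝ) (1 / β)) N k)) atTop (𝓝 1) := fun k => by
    have hlim : Tendsto (fun M : ℕ => N * (2 / Real.sqrt ((M : ℝ) - 2))) atTop (𝓝 0) := by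
      have h1 : Tendsto (fun M : ℕ => (M : ℝ) - 2) atTop atTop :=
        tendsto_atTop_add_const_right _ _ tendsto_natCast_atTop_atTop
      simpa using ((Real.tendsto_sqrt_atTop.comp h1).const_div_atTop 2).const_mul (N : ℝ)
    rw [tendsto_iff_norm_sub_tendsto_zero]
    refine squeeze_zero' (Eventually.of_forall fun M => norm_nonneg _) ?_ hlim
    filter_upwards [eventually_gt_atTop 2] with M hM
    have := isProbabilityMeasure_gamma (M := M) hβ (by omega)
    have hi := integrable_one_div_orderStat (N := N) hβ (show 1 < M by omega) k
    obtain ⟨i1, v1⟩ := integral_abs_mul_one_div_sub_one_gamma_le hβ hM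
    have hm := fun i => measurePreserving_eval (fun _ : Fin N => gammaMeasure (M : ℝ) (1 / β)) i
    have hint : ∀ i, Integrable (fun x => |β * ((M : ℝ) - 1) * (1 / x i) - 1|)
        (gammaSample β M N) := fun i => (hm i).integrable_comp_of_integrable i1
    have hval : ∀ i, ∫ x, |β * ((M : ℝ) - 1) * (1 / x i) - 1| ∂(gammaSample β M N) ≤
        2 / Real.sqrt ((M : ℝ) - 2) := fun i => by
      refine le_trans (le_of_eq ?_) v1
      conv_rhs => rw [← (hm i).map_eq]
      rw [integral_map (hm i).measurable.aemeasurable (by fun_prop :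
        Measurable fun x : ℝ => |β * ((M : ℝ) - 1) * (1 / x) - 1|).aestronglyMeasurable]
    have e : β * ((M : ℝ) - 1) * ∫ x, 1 / x (Tuple.sort x k) ∂(gammaSample β M N) - 1 =
        ∫ x, (β * ((M : ℝ) - 1) * (1 / x (Tuple.sort x k)) - 1) ∂(gammaSample β M N) := by
      rw [integral_sub (hi.const_mul _) (integrable_const _), integral_const_mul]
      simp
    rw [integral_orderStatLaw, e, Real.norm_eq_abs]
    calc _ ≤ ∫ x, |β * ((M : ℝ) - 1) * (1 / x (Tuple.sort x k)) - 1| ∂(gammaSample β M N) :=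
          abs_integral_le_integral_abs
      _ ≤ ∫ x, ∑ i, |β * ((M : ℝ) - 1) * (1 / x i) - 1| ∂(gammaSample β M N) := by
          refine integral_mono ((hi.const_mul _).sub (integrable_const _)).abs
            (integrable_finsetSum _ fun i _ => hint i) fun x => ?_
          exact Finset.single_le_sum (f := fun i => |β * ((M : ℝ) - 1) * (1 / x i) - 1|)
            (fun i _ => abs_nonneg _) (Finset.mem_univ (Tuple.sort x k))
      _ ≤ ∑ _i : Fin N, 2 / Real.sqrt ((M : ℝ) - 2) := by
          rw [integral_finsetSum _ fun i _ => hint i]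
          exact Finset.sum_le_sum fun i _ => hval i
      _ = _ := by simp
  have hsum := tendsto_finsetSum (Finset.univ.filter fun k : Fin N => k.val < n)
    fun k _ => hk k
  simp only [Finset.sum_const, Fin.card_filter_val_lt, min_eq_right hn, nsmul_eq_mul,
    mul_one] at hsum
  refine hsum.congr fun M => ?_
  rw [invOrderStatSum, Finset.mul_sum]

/-- The inverses of the `n` smallest values have the largest sum among all sets of at most `n`
values. -/
lemma sum_one_div_le_sum_orderStat {x : Fin N → ℝ} (hx : ∀ i, 0 < x i) {n : ℕ}
    {S : Finset (Fin N)} (hS : S.card ≤ n) :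
    ∑ i ∈ S, 1 / x i ≤
      ∑ k ∈ Finset.univ.filter (fun k : Fin N => k.val < n), 1 / x (Tuple.sort x k) := by
  set σ := Tuple.sort x
  set y : Fin N → ℝ := fun k => 1 / x (σ k) with hy
  have hy0 : ∀ k, 0 ≤ y k := fun k => (one_div_pos.2 (hx _)).le
  have hanti : ∀ k l, k ≤ l → y l ≤ y k := fun k l hkl =>
    one_div_le_one_div_of_le (hx _) (Tuple.monotone_sort x hkl)
  set S' : Finset (Fin N) := S.map σ.symm.toEmbedding with hS'
  have hcard : S'.card ≤ n := by rw [hS', Finset.card_map]; exact hS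
  have e : ∑ i ∈ S, 1 / x i = ∑ k ∈ S', y k := by
    rw [hS', Finset.sum_map]
    simp [hy]
  rw [e]
  set A := Finset.univ.filter (fun k : Fin N => k.val < n) with hA
  change ∑ k ∈ S', y k ≤ ∑ k ∈ A, y k
  by_cases hn : n < N
  · have hAc : A.card = n := by rw [hA, Fin.card_filter_val_lt, min_eq_right hn.le]
    set c := y ⟨n, hn⟩
    have hin : ∀ k ∈ A, 0 ≤ y k - c := fun k hk => by
      have : k.val < n := by simpa [hA] using hk
      exact sub_nonneg.2 (hanti _ _ (Fin.le_def.2 this.le))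
    have hout : ∀ k ∉ A, y k - c ≤ 0 := fun k hk => by
      have : n ≤ k.val := by simpa [hA] using hk
      exact sub_nonpos.2 (hanti _ _ (Fin.le_def.2 this))
    have h1 : ∑ k ∈ S', (y k - c) ≤ ∑ k ∈ A, (y k - c) := by
      rw [← Finset.sum_inter_add_sum_sdiff S' A]
      have h2 : ∑ k ∈ S' \ A, (y k - c) ≤ 0 :=
        Finset.sum_nonpos fun k hk => hout k (Finset.mem_sdiff.1 hk).2
      have h3 : ∑ k ∈ S' ∩ A, (y k - c) ≤ ∑ k ∈ A, (y k - c) :=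
        Finset.sum_le_sum_of_subset_of_nonneg Finset.inter_subset_right fun k hk _ => hin k hk
      linarith
    rw [Finset.sum_sub_distrib, Finset.sum_sub_distrib, Finset.sum_const, Finset.sum_const, hAc,
      nsmul_eq_mul, nsmul_eq_mul] at h1
    have h4 : (S'.card : ℝ) * c ≤ n * c :=
      mul_le_mul_of_nonneg_right (by exact_mod_cast hcard) (hy0 _)
    linarith
  · have hAu : A = Finset.univ := by
      ext k
      have := k.isLt
      simp only [hA, Finset.mem_filter, Finset.mem_univ, true_and, iff_true]
      omega
    rw [hAu]
    exact Finset.sum_le_univ_sum_of_nonneg hy0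

lemma ae_pos_gammaSample (hβ : 0 < β) (hM : 0 < M) :
    ∀ᵐ x ∂(gammaSample β M N), ∀ i, 0 < x i := by
  have := isProbabilityMeasure_gamma (M := M) hβ hM
  refine ae_all_iff.2 fun i => ?_
  exact (measurePreserving_eval (fun _ : Fin N => gammaMeasure (M : ℝ)
    (1 / β)) i).quasiMeasurePreserving.ae (ae_pos_gammaMeasure _ _)

/-- Among `K` values, the `n` smallest have an inverse sum at least that of the first `m` values and
the `n - m` smallest of the other values; this is the inequality of the means. -/
lemma add_invOrderStatSum_le (hβ : 0 < β) (hM : 1 < M) {m K n : ℕ} (hm : m ≤ n) (hmK : m ≤ K) :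
    m * (1 / (β * ((M : ℝ) - 1))) + invOrderStatSum β M (K - m) (n - m) ≤
      invOrderStatSum β M K n := by
  have := isProbabilityMeasure_gamma (M := M) hβ (by omega)
  set ι : Fin (K - m) → Fin K := fun i => ⟨m + i.val, by have := i.isLt; omega⟩ with hι
  have hinj : Function.Injective ι := fun i j h => by
    simp only [hι, Fin.mk.injEq] at h
    exact Fin.ext (by omega)
  set F : (Fin (K - m) → ℝ) → ℝ := fun z =>
    ∑ k ∈ Finset.univ.filter (fun k : Fin (K - m) => k.val < n - m), 1 / z (Tuple.sort z k)
  have hFint : Integrable F (gammaSample β M (K - m)) :=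
    integrable_finsetSum _ fun k _ => integrable_one_div_orderStat hβ hM k
  have hmp := measurePreserving_pi_comp (gammaMeasure (M : ℝ) (1 / β)) hinj
  have hFint' : Integrable (fun x : Fin K → ℝ => F fun i => x (ι i)) (gammaSample β M K) :=
    hmp.integrable_comp_of_integrable hFint
  have hFval : ∫ x : Fin K → ℝ, F (fun i => x (ι i)) ∂(gammaSample β M K) =
      invOrderStatSum β M (K - m) (n - m) := by
    rw [invOrderStatSum_eq hβ hM]
    conv_rhs => rw [gammaSample, ← hmp.map_eq]
    rw [integral_map hmp.measurable.aemeasurable (by rw [hmp.map_eq]; exact hFint.1)]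
  set S₁ : Finset (Fin K) := Finset.univ.filter fun i : Fin K => i.val < m with hS₁
  have hS₁c : S₁.card = m := by rw [hS₁, Fin.card_filter_val_lt, min_eq_right hmK]
  have hS₁int : Integrable (fun x : Fin K → ℝ => ∑ i ∈ S₁, 1 / x i) (gammaSample β M K) :=
    integrable_finsetSum _ fun i _ => (integral_one_div_coord hβ hM i).1
  have hS₁val : ∫ x : Fin K → ℝ, ∑ i ∈ S₁, 1 / x i ∂(gammaSample β M K) =
      m * (1 / (β * ((M : ℝ) - 1))) := by
    rw [integral_finsetSum _ fun i _ => (integral_one_div_coord hβ hM i).1,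
      Finset.sum_congr rfl fun i _ => (integral_one_div_coord hβ hM i).2]
    rw [Finset.sum_const, hS₁c, nsmul_eq_mul]
  rw [← hS₁val, ← hFval, invOrderStatSum_eq hβ hM, ← integral_add hS₁int hFint']
  refine integral_mono_ae (hS₁int.add hFint')
    (integrable_finsetSum _ fun k _ => integrable_one_div_orderStat hβ hM k) ?_
  filter_upwards [ae_pos_gammaSample (N := K) hβ (show 0 < M by omega)] with x hx
  set z : Fin (K - m) → ℝ := fun i => x (ι i)
  set S₂ : Finset (Fin K) := (Finset.univ.filter (fun k : Fin (K - m) => k.val < n - m)).map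
    ⟨fun k => ι (Tuple.sort z k), hinj.comp (Tuple.sort z).injective⟩ with hS₂
  have hFz : F z = ∑ i ∈ S₂, 1 / x i := by
    rw [hS₂, Finset.sum_map]
    rfl
  have hdisj : Disjoint S₁ S₂ := by
    rw [Finset.disjoint_left]
    intro i hi hi'
    simp only [hS₁, Finset.mem_filter, Finset.mem_univ, true_and] at hi
    rw [hS₂, Finset.mem_map] at hi'
    obtain ⟨k, -, rfl⟩ := hi'
    simp [hι] at hi
  have hcard : (S₁ ∪ S₂).card ≤ n := by
    have h1 := Finset.card_union_le S₁ S₂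
    have h2 : S₂.card ≤ n - m := by
      rw [hS₂, Finset.card_map, Fin.card_filter_val_lt]; exact min_le_right _ _
    omega
  have h := sum_one_div_le_sum_orderStat hx hcard
  rw [Finset.sum_union hdisj, ← hFz] at h
  exact h

end OrderStatistics

/-! ### The large-antenna expression of the loss under channel-magnitude grouping -/

lemma asympRateLast_eq {P β N₀ A a : ℝ} (hβ : 0 < β) {KB M : ℕ}
    (ha : β * ((M : ℝ) - 1) * A = a) :
    asympRateLast P N₀ A KB M = Real.logb 2 (1 + P * β / N₀ * (((M : ℝ) - KB) / a)) := by
  unfold asympRateLast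
  congr 2
  rw [← ha, mul_assoc, ← div_div]
  field_simp

lemma mul_coeffMisreport {β δ : ℝ} (hβ : 0 < β) {T KB KM M : ℕ} (hM : 1 < M) :
    β * ((M : ℝ) - 1) * coeffMisreport β δ T KB KM M =
      KM / δ + β * ((M : ℝ) - 1) * invOrderStatSum β M (T * KB - KM) (KB - KM) := by
  have hM' : (M : ℝ) - 1 ≠ 0 := by
    rw [sub_ne_zero]; exact_mod_cast hM.ne'
  unfold coeffMisreport
  rw [mul_add]
  congr 1
  rw [mul_assoc δ, div_mul_eq_div_div]
  field_simp

lemma tendsto_asympRateLast_sub {P β N₀ S : ℝ} (hP : 0 < P) (hβ : 0 < β) (hN₀ : 0 < N₀)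
    (hS : 0 < S) {A : ℕ → ℝ} (KB : ℕ)
    (hA : Tendsto (fun M : ℕ => β * ((M : ℝ) - 1) * A M) atTop (𝓝 S)) :
    Tendsto (fun M : ℕ => asympRateLast P N₀ (A M) KB M - Real.logb 2 M) atTop
      (𝓝 (rateOffset P β N₀ S)) := by
  have h1 : Tendsto (fun M : ℕ => P * β / N₀ * (((M : ℝ) - KB) / (β * ((M : ℝ) - 1) * A M)) / M)
      atTop (𝓝 (P * β / N₀ * (1 / S))) := by
    have h2 : Tendsto (fun M : ℕ => 1 - KB * (1 / (M : ℝ))) atTop (𝓝 (1 - KB * 0)) :=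
      ((tendsto_one_div_atTop_nhds_zero_nat (𝕜 := ℝ)).const_mul (KB : ℝ)).const_sub 1
    rw [mul_zero, sub_zero] at h2
    refine ((h2.div hA hS.ne').const_mul (P * β / N₀)).congr' ?_
    filter_upwards [eventually_gt_atTop 0] with M hM
    have hM' : (M : ℝ) ≠ 0 := by exact_mod_cast hM.ne'
    have e : 1 - KB * (1 / (M : ℝ)) = ((M : ℝ) - KB) / M := by field_simp
    simp only [Pi.div_apply, e]
    ring
  exact (tendsto_logb_one_add_sub (by positivity) h1).congr fun M => by
    rw [asympRateLast_eq hβ rfl]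

lemma tendsto_logb_mul_asympLossCM {P β N₀ δ : ℝ} (hP : 0 < P) (hβ : 0 < β) (hN₀ : 0 < N₀)
    (hδ₀ : 0 < δ) {T KB KM : ℕ} (hT : 1 ≤ T) (hKB : 1 ≤ KB) (hKM : KM ≤ KB)
    (hhonest : KM < T * KB) :
    Tendsto (fun M : ℕ => Real.logb 2 M * asympLossCM P β N₀ δ T KB KM M) atTop
      (𝓝 (((KB : ℝ) - KM) / (T * KB - KM) *
        (rateOffset P β N₀ KB - rateOffset P β N₀ ((KB : ℝ) - KM + KM / δ)))) := by
  have hTpos : (0 : ℝ) < T := by exact_mod_cast hT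
  have hKBpos : (0 : ℝ) < KB := by exact_mod_cast hKB
  have hH : (T : ℝ) * KB - KM ≠ 0 := by
    rw [sub_ne_zero]; exact_mod_cast hhonest.ne'
  have hr : Tendsto (fun M : ℕ => asympRateRand P β N₀ KB M - Real.logb 2 M) atTop
      (𝓝 (rateOffset P β N₀ KB)) := tendsto_logb_one_add_mul_div_sub hP hβ hN₀ hKBpos KB
  have ha := tendsto_asympRateLast_sub hP hβ hN₀ hKBpos (A := coeffAccurate β T KB) KB
    (tendsto_mul_invOrderStatSum hβ (Nat.le_mul_of_pos_left KB hT))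
  have hm := tendsto_asympRateLast_sub hP hβ hN₀ (totalCost_pos hδ₀ hKB hKM)
    (A := coeffMisreport β δ T KB KM) KB (by
      have h1 := (tendsto_mul_invOrderStatSum hβ
        (show KB - KM ≤ T * KB - KM from
          Nat.sub_le_sub_right (Nat.le_mul_of_pos_left KB hT) KM)).const_add ((KM : ℝ) / δ)
      rw [Nat.cast_sub hKM, add_comm] at h1
      refine h1.congr' ?_
      filter_upwards [eventually_gt_atTop 1] with M hM
      rw [mul_coeffMisreport hβ hM])
  have h := ((tendsto_logb_mul_div_sub_one ha hr).const_mul (1 / (T : ℝ))).sub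
    ((tendsto_logb_mul_div_sub_one hm hr).const_mul (((KB : ℝ) - KM) / (T * KB - KM)))
  have e : 1 / (T : ℝ) * (rateOffset P β N₀ KB - rateOffset P β N₀ KB) -
      ((KB : ℝ) - KM) / (T * KB - KM) *
        (rateOffset P β N₀ ((KB : ℝ) - KM + KM / δ) - rateOffset P β N₀ KB) =
      ((KB : ℝ) - KM) / (T * KB - KM) *
        (rateOffset P β N₀ KB - rateOffset P β N₀ ((KB : ℝ) - KM + KM / δ)) := by ring
  rw [e] at h
  refine h.congr fun M => ?_
  have hconst : -((KM : ℝ) * ((T : ℝ) - 1) / (T * (T * KB - KM))) =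
      ((KB : ℝ) - KM) / (T * KB - KM) - 1 / T := by
    field_simp
    ring
  rw [asympLossCM, hconst, ← div_div, mul_div_mul_comm]
  ring

/-- The decrease of the convex function `x ↦ log (1 + c / x)` over an interval of given length gets
smaller to the right. -/
lemma logb_one_add_div_sub_le {c x u d : ℝ} (hc : 0 < c) (hx : 0 < x) (hxu : x ≤ u) (hd : 0 ≤ d) :
    Real.logb 2 (1 + c / u) - Real.logb 2 (1 + c / (u + d)) ≤
      Real.logb 2 (1 + c / x) - Real.logb 2 (1 + c / (x + d)) := by
  have key : ∀ z : ℝ, 0 < z → Real.logb 2 (1 + c / z) - Real.logb 2 (1 + c / (z + d)) =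
      Real.logb 2 (1 + c * d / (z * (z + c + d))) := fun z hz => by
    have hzd : 0 < z + d := by linarith
    rw [← Real.logb_div (by positivity) (by positivity)]
    congr 1
    have h1 : z + d + c ≠ 0 := by positivity
    field_simp
    ring
  have hu : 0 < u := by linarith
  rw [key x hx, key u hu]
  refine Real.logb_le_logb_of_le one_lt_two (by positivity) ?_
  gcongr

lemma asympLossCM_le_upperLossCM {P β N₀ δ : ℝ} (hP : 0 < P) (hβ : 0 < β) (hN₀ : 0 < N₀)
    (hδ₀ : 0 < δ) (hδ₁ : δ < 1) {T KB KM : ℕ} (hT : 1 ≤ T) (hKB : 1 ≤ KB) (hKM : KM ≤ KB)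
    (hhonest : KM < T * KB) {M : ℕ} (hM : KB < M) :
    asympLossCM P β N₀ δ T KB KM M ≤ upperLossCM P β N₀ δ T KB KM M := by
  have hTpos : (0 : ℝ) < T := by exact_mod_cast hT
  have hT1 : (1 : ℝ) ≤ T := by exact_mod_cast hT
  have hKBpos : (0 : ℝ) < KB := by exact_mod_cast hKB
  have hKM' : (KM : ℝ) ≤ KB := by exact_mod_cast hKM
  have hKM0 : (0 : ℝ) ≤ KM := Nat.cast_nonneg KM
  have hH : 0 < (T : ℝ) * KB - KM := by
    rw [sub_pos]; exact_mod_cast hhonest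
  have hKBK : KB ≤ T * KB := Nat.le_mul_of_pos_left KB hT
  have hM1 : 1 < M := by omega
  have hMK : (0 : ℝ) < (M : ℝ) - KB := by
    rw [sub_pos]; exact_mod_cast hM
  have hMpos : (0 : ℝ) < (M : ℝ) - 1 := by
    rw [sub_pos]; exact_mod_cast hM1
  have hβM : 0 < β * ((M : ℝ) - 1) := by positivity
  set b := β * ((M : ℝ) - 1) * invOrderStatSum β M (T * KB - KM) (KB - KM) with hb
  set a := β * ((M : ℝ) - 1) * coeffAccurate β T KB M with ha
  have hab : KM + b ≤ a := by
    have h := mul_le_mul_of_nonneg_left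
      (add_invOrderStatSum_le hβ hM1 hKM hhonest.le) hβM.le
    rw [mul_add, ← hb] at h
    refine le_trans (le_of_eq ?_) h
    field_simp
  have hbh : (KB : ℝ) - KM ≤ b := by
    have h := mul_le_mul_of_nonneg_left (add_invOrderStatSum_le hβ hM1 (le_refl (KB - KM))
      (Nat.sub_le_sub_right hKBK KM)) hβM.le
    rw [mul_add, ← hb, Nat.cast_sub hKM] at h
    have h0 : ∀ N, invOrderStatSum β M N (KB - KM - (KB - KM)) = 0 := fun N => by
      simp [invOrderStatSum]
    rw [h0, mul_zero, add_zero] at h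
    refine le_trans (le_of_eq ?_) h
    field_simp
  set q : ℝ := KM / δ with hq
  have hqKM : (KM : ℝ) ≤ q := by
    rw [hq, le_div_iff₀ hδ₀]; nlinarith
  set d := b - (KB - KM) with hd
  have hd0 : 0 ≤ d := by rw [hd]; linarith
  set c := P * β / N₀ * ((M : ℝ) - KB) with hc
  have hc0 : 0 < c := by positivity
  have hφ : ∀ x : ℝ, P * β / N₀ * (((M : ℝ) - KB) / x) = c / x := fun x => by rw [hc]; ring
  have hRa : asympRateLast P N₀ (coeffAccurate β T KB M) KB M = Real.logb 2 (1 + c / a) := by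
    rw [asympRateLast_eq hβ ha.symm, hφ]
  have hRm : asympRateLast P N₀ (coeffMisreport β δ T KB KM M) KB M =
      Real.logb 2 (1 + c / (KB - KM + q + d)) := by
    rw [asympRateLast_eq hβ (mul_coeffMisreport hβ hM1), hφ, ← hb, ← hq, hd]
    congr 3
    ring
  have hRr : asympRateRand P β N₀ KB M = Real.logb 2 (1 + c / KB) := by
    rw [asympRateRand, hφ]
  set r := Real.logb 2 (1 + c / KB)
  have hr0 : 0 < r := Real.logb_pos one_lt_two (by
    have : 0 < c / KB := by positivity
    linarith)
  have hconv := logb_one_add_div_sub_le (u := KB - KM + q) hc0 hKBpos (by linarith) hd0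
  have hmono : Real.logb 2 (1 + c / a) ≤ Real.logb 2 (1 + c / (KB + d)) := by
    have : (KB : ℝ) + d ≤ a := by rw [hd]; linarith
    have ha0 : 0 < a := by linarith
    refine Real.logb_le_logb_of_le one_lt_two (by positivity) ?_
    gcongr
  have hnonneg : 0 ≤ Real.logb 2 (1 + c / (KB - KM + q)) -
      Real.logb 2 (1 + c / (KB - KM + q + d)) := by
    have h1 : 0 < (KB : ℝ) - KM + q := by linarith
    have h2 := div_le_div_of_nonneg_left hc0.le h1 (le_add_of_nonneg_right hd0)
    rw [sub_nonneg]
    exact Real.logb_le_logb_of_le one_lt_two (by positivity) (by linarith)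
  set x := Real.logb 2 (1 + c / a)
  set m := Real.logb 2 (1 + c / (KB - KM + q + d))
  set m' := Real.logb 2 (1 + c / (KB - KM + q))
  set l := ((KB : ℝ) - KM) / (T * KB - KM) with hl
  -- the honest users of the last block make up at most a share `1 / T` of all honest users
  have hl1 : l ≤ 1 / T := by
    rw [hl, div_le_div_iff₀ hH hTpos]; nlinarith
  have hkey : l * (m' - m) ≤ 1 / T * (r - x) :=
    (mul_le_mul_of_nonneg_right hl1 hnonneg).trans
      (mul_le_mul_of_nonneg_left (by linarith) (by positivity))
  have hconst : -((KM : ℝ) * ((T : ℝ) - 1) / (T * (T * KB - KM))) = l - 1 / T := by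
    rw [hl]
    field_simp
    ring
  have hup : upperLossCM P β N₀ δ T KB KM M = l * (1 - m' / r) := by
    rw [upperLossCM, asympSingleBlockLoss, hφ, hφ]
  have hlo : asympLossCM P β N₀ δ T KB KM M = l - 1 / T + 1 / T * (x / r) - l * (m / r) := by
    rw [asympLossCM, hRa, hRm, hRr, hconst, ← div_div, mul_div_mul_comm]
    ring
  rw [hup, hlo]
  have : l * (1 - m' / r) - (l - 1 / T + 1 / T * (x / r) - l * (m / r)) =
      (1 / T * (r - x) - l * (m' - m)) / r := by
    field_simp
    ring
  have h2 : 0 ≤ (1 / T * (r - x) - l * (m' - m)) / r := div_nonneg (by linarith) hr0.le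
  linarith

lemma tendsto_logb_mul_upperLossCM {P β N₀ δ : ℝ} (hP : 0 < P) (hβ : 0 < β) (hN₀ : 0 < N₀)
    (hδ₀ : 0 < δ) (T : ℕ) {KB KM : ℕ} (hKB : 1 ≤ KB) (hKM : KM ≤ KB) :
    Tendsto (fun M : ℕ => Real.logb 2 M * upperLossCM P β N₀ δ T KB KM M) atTop
      (𝓝 (((KB : ℝ) - KM) / (T * KB - KM) *
        (rateOffset P β N₀ KB - rateOffset P β N₀ ((KB : ℝ) - KM + KM / δ)))) := by
  refine ((tendsto_logb_mul_asympSingleBlockLoss hP hβ hN₀ hδ₀ hKB hKM).const_mul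
    (((KB : ℝ) - KM) / (T * KB - KM))).congr fun M => ?_
  rw [upperLossCM]
  ring

end MisreportRR

end

theorem corollary1 (P β N₀ δ : ℝ) (hP : 0 < P) (hβ : 0 < β) (hN₀ : 0 < N₀)
    (hδ₀ : 0 < δ) (hδ₁ : δ < 1) (T KB KM : ℕ) (hT : 1 ≤ T) (hKB : 1 ≤ KB) (hKM : KM ≤ KB)
    (hhonest : KM < T * KB) :
    -- the rate loss is bounded above by the stated bound, as the number of antennas grows
    (∀ ε > 0, ∀ᶠ M : ℕ in atTop,
      MisreportRR.lossCM P β N₀ δ T KB KM M ≤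
        MisreportRR.upperLossCM P β N₀ δ T KB KM M + ε / Real.logb 2 M) ∧
    -- more precisely: its large-antenna expression obeys the bound exactly
    ((fun M : ℕ => MisreportRR.lossCM P β N₀ δ T KB KM M -
        MisreportRR.asympLossCM P β N₀ δ T KB KM M)
      =o[atTop] fun M : ℕ => 1 / Real.logb 2 M) ∧
    (∀ M : ℕ, KB < M →
      MisreportRR.asympLossCM P β N₀ δ T KB KM M ≤
        MisreportRR.upperLossCM P β N₀ δ T KB KM M) ∧
    -- the factor `θ(KM | KB)` in the bound is the asymptotic single-block rate loss
    (KM < KB →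
      (fun M : ℕ => MisreportRR.singleBlockLoss P β N₀ δ KB KM M -
          MisreportRR.asympSingleBlockLoss P β N₀ δ KB KM M)
        =o[atTop] fun M : ℕ => 1 / Real.logb 2 M) ∧
    -- the bound vanishes for `KM = KB`
    (KM = KB → ∀ M : ℕ, MisreportRR.upperLossCM P β N₀ δ T KB KM M = 0) ∧
    -- for `KM = 1` the bound is the rate loss under random grouping: exactly with the exact
    -- single-block loss, and asymptotically with its large-antenna expression
    (KM = 1 →
      (∀ M : ℕ, KB ≤ M → MisreportRR.lossRand P β N₀ δ T KB KM M =
        ((KB : ℝ) - KM) / (T * KB - KM) * MisreportRR.singleBlockLoss P β N₀ δ KB KM M) ∧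
      ((fun M : ℕ => MisreportRR.lossRand P β N₀ δ T KB KM M -
          MisreportRR.upperLossCM P β N₀ δ T KB KM M)
        =o[atTop] fun M : ℕ => 1 / Real.logb 2 M)) := by
  have hup := MisreportRR.tendsto_logb_mul_upperLossCM hP hβ hN₀ hδ₀ T hKB hKM
  have hCM := MisreportRR.tendsto_logb_mul_lossCM hP hβ hN₀ hδ₀ hδ₁ hT hKB hKM hhonest
  refine ⟨fun ε hε => ?_, MisreportRR.isLittleO_one_div_logb hCM
      (MisreportRR.tendsto_logb_mul_asympLossCM hP hβ hN₀ hδ₀ hT hKB hKM hhonest),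
    fun M hM => MisreportRR.asympLossCM_le_upperLossCM hP hβ hN₀ hδ₀ hδ₁ hT hKB hKM hhonest hM,
    fun h => MisreportRR.singleBlockLoss_sub_isLittleO hP hβ hN₀ hδ₀ hδ₁ h,
    fun h M => by simp [MisreportRR.upperLossCM, h], ?_⟩
  · filter_upwards [(MisreportRR.isLittleO_one_div_logb hCM hup).def hε,
      MisreportRR.tendsto_logb_natCast.eventually_gt_atTop 0] with M hM hL
    rw [Real.norm_eq_abs, Real.norm_eq_abs, abs_of_pos (one_div_pos.2 hL), mul_one_div] at hM
    linarith [(abs_le.1 hM).2]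
  · rintro rfl
    have hloss : ∀ M : ℕ, KB ≤ M → MisreportRR.lossRand P β N₀ δ T KB 1 M =
        ((KB : ℝ) - 1) / (T * KB - 1) * MisreportRR.singleBlockLoss P β N₀ δ KB 1 M := fun M hM =>
      MisreportRR.lossRand_one hP hβ hN₀ hδ₀ hδ₁ hT hKB hhonest (by omega)
    simp only [Nat.cast_one]
    refine ⟨hloss, ?_⟩
    have h2 : (fun M : ℕ => ((KB : ℝ) - 1) / (T * KB - 1) *
        (MisreportRR.singleBlockLoss P β N₀ δ KB 1 M -
          MisreportRR.asympSingleBlockLoss P β N₀ δ KB 1 M))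
        =o[atTop] fun M : ℕ => 1 / Real.logb 2 M := by
      rcases hKM.lt_or_eq with h | h
      · exact (MisreportRR.singleBlockLoss_sub_isLittleO hP hβ hN₀ hδ₀ hδ₁ h).const_mul_left _
      · simp [← h]
    refine h2.congr' ?_ EventuallyEq.rfl
    filter_upwards [eventually_ge_atTop KB] with M hM
    rw [hloss M hM, MisreportRR.upperLossCM, Nat.cast_one, mul_sub]
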